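/- Let $A=S^1\times[-1,1]$ with $S^1=\mathbb R/\mathbb Z$, and let $p:\mathbb R\times[-1,1]\to A$ be the universal covering. For a homeomorphism $f:A\to A$, a lift $\tilde f$ of $f$ and $z\in A$, the rotation number of $z$ with respect to $\tilde f$ is $$\rho_{\tilde f}(z)=\lim_{n\to\infty}\frac{\pi_1(\tilde f^{\,n}(\tilde z))-\pi_1(\tilde z)}{n}$$ if the limit exists, where $p(\tilde z)=z$ and $\pi_1$ is the projection to $\mathbb R$. Say that $f$ has a *rotary horseshoe* if there are a lift $\tilde f$, a compact $f$-invariant set $\Omega\subset A$ and a homeomorphism $c:\Omega\to\Sigma_2=\{0,1\}^{\mathbb Z}$ conjugating $f|_\Omega$ to the shift $\sigma$ such that for every $z\in\Omega$ $$\rho_{\tilde f}(z)=\lim_{N\to\infty}\frac1{N+1}\sum_{i=0}^{N}\mathbf 1_{C_1}(\sigma^i(c(z))),\qquad C_1=\{s\in\Sigma_2:s_0=1\},$$ in the sense that one limit exists if and only if the other does, and then they agree. A *Denjoy example* is an orientation-preserving homeomorphism of $S^1$ with irrational rotation number that is not minimal. A compact $f$-invariant set $D\subset A$ is a *Denjoy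 minimal set with intrinsic rotation number* $\alpha$ if $f|_D$ is topologically conjugate to the restriction of a Denjoy example with rotation number $\alpha$ (mod $1$) to its minimal set. It has *extrinsic rotation number* $\beta\in S^1$ if for some lift $\tilde f$ all points of $D$ have one and the same rotation number with respect to $\tilde f$, and its class mod $1$ is $\beta$. A compact invariant set is *strictly ergodic* if it is minimal and carries exactly one invariant Borel probability measure; the set $\mathcal S(A,f)$ of strictly ergodic sets has the weak topology, i.e. the topology induced by sending each of its members to its invariant measure, where measures carry the topology of weak convergence. Denjoy minimal sets are strictly ergodic; let $\mathcal D_{\alpha,\beta}(A,f)\subset\mathcal S(A,f)$ be the subspace of Denjoy minimal sets with intrinsic rotation number $\alpha$ and extrinsic rotation number $\beta$. **Proposition 4.2.** If a homeomorphism $f:A\to A$ has a rotary horseshoe, then for every irrational $\alpha$, every $\beta\in S^1$ with $\beta\neq0$, and every natural number $n$, the space $\mathcal D_{\alpha,\beta}(A,f)$ contains a topological ball of dimension $n$, i.e. a subspace homeomorphic to the closed unit ball of $\mathbb R^n$. -/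

import Mathlib

open Filter Topology MeasureTheory

namespace DenjoyAnnulus

noncomputable section

/-! ### Minimal and strictly ergodic sets, and the weak topology -/

section General

variable {Z : Type*} [TopologicalSpace Z]

/-- A nonempty compact invariant set all of whose (two-sided) orbits are dense in it. -/
def IsMinimalSet (f : Z ≃ₜ Z) (Y : Set Z) : Prop :=
  Y.Nonempty ∧ IsCompact Y ∧ f '' Y = Y ∧
    ∀ x ∈ Y, Y ⊆ closure (Set.range fun n : ℤ => (f ^ n) x)

variable [MeasurableSpace Z]

/-- `μ` is an `f`-invariant Borel probability measure carried by `Y`. -/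
def IsInvariantOn (f : Z ≃ₜ Z) (Y : Set Z) (μ : ProbabilityMeasure Z) : Prop :=
  MeasurePreserving f (μ : Measure Z) (μ : Measure Z) ∧ (μ : Measure Z) Yᶜ = 0

/-- The set `𝒮(Z, f)` of strictly ergodic (minimal and uniquely ergodic) subsets of `Z`. -/
@[ext]
structure StrictlyErgodicSet (f : Z ≃ₜ Z) where
  /-- the underlying set -/
  carrier : Set Z
  minimal : IsMinimalSet f carrier
  uniquelyErgodic : ∃! μ : ProbabilityMeasure Z, IsInvariantOn f carrier μ

/-- The unique invariant probability measure of a strictly ergodic set. -/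
def StrictlyErgodicSet.measure {f : Z ≃ₜ Z} (Y : StrictlyErgodicSet f) : ProbabilityMeasure Z :=
  Y.uniquelyErgodic.choose

/-- The weak topology on `𝒮(Z, f)`: the one induced by the inclusion `Y ↦ μ_Y` into the
probability measures with the topology of weak convergence. -/
instance [OpensMeasurableSpace Z] (f : Z ≃ₜ Z) : TopologicalSpace (StrictlyErgodicSet f) :=
  TopologicalSpace.induced StrictlyErgodicSet.measure inferInstance

end General

/-! ### Denjoy minimal sets -/

/-- The homeomorphism `g` of the circle `ℝ/ℤ` preserves orientation and has
rotation number `ρ ∈ ℝ/ℤ`. -/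
def HasCircleRotationNumber (g : UnitAddCircle ≃ₜ UnitAddCircle) (ρ : UnitAddCircle) : Prop :=
  ∃ G : CircleDeg1Lift, (∀ x : ℝ, ((G x : ℝ) : UnitAddCircle) = g (x : UnitAddCircle)) ∧
    ((G.translationNumber : ℝ) : UnitAddCircle) = ρ

/-- A Denjoy example with rotation number `α`: a circle homeomorphism with irrational rotation
number that is not minimal. -/
def IsDenjoyExample (g : UnitAddCircle ≃ₜ UnitAddCircle) (α : ℝ) : Prop :=
  Irrational α ∧ HasCircleRotationNumber g (α : UnitAddCircle) ∧ ¬ IsMinimalSet g Set.univ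

/-- `D` is a Denjoy minimal set of `f` with intrinsic rotation number `α`: it is a compact
invariant set on which `f` is topologically conjugate to the minimal set of a Denjoy example with
rotation number `α`.  (The intrinsic rotation number is only determined up to sign; reflecting
the circle shows that this predicate is invariant under `α ↦ -α`.) -/
def IsDenjoyMinimalSet {Z : Type*} [TopologicalSpace Z] (f : Z ≃ₜ Z) (D : Set Z) (α : ℝ) : Prop :=
  IsCompact D ∧ f '' D = D ∧
    ∃ (g : UnitAddCircle ≃ₜ UnitAddCircle) (Y : Set UnitAddCircle),
      IsDenjoyExample g α ∧ IsMinimalSet g Y ∧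
        ∃ h : D ≃ₜ Y, ∀ x y : D, (y : Z) = f x → (h y : UnitAddCircle) = g (h x)

/-! ### Annulus homeomorphisms, rotation numbers, rotary horseshoes -/

/-- The closed annulus `S¹ × [-1, 1]`. -/
abbrev Annulus : Type := UnitAddCircle × Set.Icc (-1 : ℝ) 1

/-- Its universal cover, the strip `ℝ × [-1, 1]`. -/
abbrev Strip : Type := ℝ × Set.Icc (-1 : ℝ) 1

/-- The covering projection. -/
def proj (w : Strip) : Annulus := ((w.1 : UnitAddCircle), w.2)

/-- `F` is a lift of `f` to the strip. -/
def IsLift (F : Strip → Strip) (f : Annulus ≃ₜ Annulus) : Prop :=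
  Continuous F ∧ ∀ w, proj (F w) = f (proj w)

/-- With respect to the lift `F`, the limit defining the rotation number of the point `z` exists
and equals `t`. -/
def HasRotationNumber (F : Strip → Strip) (z : Annulus) (t : ℝ) : Prop :=
  ∀ w : Strip, proj w = z →
    Tendsto (fun n : ℕ => ((F^[n] w).1 - w.1) / (n : ℝ)) atTop (𝓝 t)

/-- The set `D` has extrinsic rotation number `β ∈ ℝ/ℤ` under `f`. -/
def HasExtrinsicRotationNumber (f : Annulus ≃ₜ Annulus) (D : Set Annulus)
    (β : UnitAddCircle) : Prop :=
  ∃ F : Strip → Strip, IsLift F f ∧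
    ∃ t : ℝ, (t : UnitAddCircle) = β ∧ ∀ z ∈ D, HasRotationNumber F z t

/-- The sequence space `Σ₂ = {0,1}^ℤ`. -/
abbrev TwoShift : Type := ℤ → Fin 2

/-- The shift map. -/
def shift (s : TwoShift) : TwoShift := fun i => s (i + 1)

/-- The cylinder `C₁` of sequences whose zeroth symbol is `1`. -/
def cylinderOne : Set TwoShift := {s | s 0 = 1}

/-- The asymptotic average number of ones in the forward half of `s` exists and equals `t`. -/
def HasFrequencyOfOnes (s : TwoShift) (t : ℝ) : Prop :=
  Tendsto (fun N : ℕ =>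
    (∑ i ∈ Finset.range (N + 1), cylinderOne.indicator (fun _ => (1 : ℝ)) (shift^[i] s)) /
      ((N : ℝ) + 1)) atTop (𝓝 t)

/-- `f` has a rotary horseshoe: a compact invariant set `Ω` with a conjugacy `c` to the full
two-shift such that, for a suitable lift `F` of `f`, the rotation number of each `z ∈ Ω` is the
asymptotic average number of ones in `c z` (one limit exists if and only if the other does, and
then they agree). -/
def HasRotaryHorseshoe (f : Annulus ≃ₜ Annulus) : Prop :=
  ∃ (F : Strip → Strip) (Ω : Set Annulus) (c : Ω ≃ₜ TwoShift),
    IsLift F f ∧ IsCompact Ω ∧ f '' Ω = Ω ∧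
    (∀ x y : Ω, (y : Annulus) = f x → c y = shift (c x)) ∧
    ∀ (z : Ω) (t : ℝ), HasRotationNumber F z t ↔ HasFrequencyOfOnes (c z) t

/-- `𝒟_{α,β}(A, f)`: the Denjoy minimal sets of `f` with intrinsic rotation number `α` and
extrinsic rotation number `β`, as a subset of the space `𝒮(A, f)` of strictly ergodic sets with
the weak topology (Denjoy minimal sets are always strictly ergodic). -/
def denjoySets (f : Annulus ≃ₜ Annulus) (α : ℝ) (β : UnitAddCircle) :
    Set (StrictlyErgodicSet f) :=
  {D | IsDenjoyMinimalSet f D.carrier α ∧ HasExtrinsicRotationNumber f D.carrier β}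

end

end DenjoyAnnulus

namespace DenjoyAnnulus

noncomputable section

/-! ### Irrational rotations: equidistribution and unique ergodicity -/

/-! The horseshoe reduces everything to the full two-shift. Since `β ≠ 0`, it has a representative
`t` in `(0, 1)`, and a subset of the horseshoe all of whose codes have frequency of ones `t` has
extrinsic rotation number `β`.

Such sets come from coding a rotation. Take a union of `n + 1` disjoint half-open arcs of total
length `t` and record the visits of the orbit of `x` under rotation by `α`. The right and left
continuous versions of the indicator give two codes, which differ only when the orbit of `x` meets
an end of an arc. All these codes together form a copy of the minimal set of a Denjoy example: a
monotone blow-up of the line opens each such `x` into a gap `[L x, R x]`, the two gap ends receive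
the two codes, and the rotation lifts to a circle homeomorphism preserving the gap ends
(`exists_blowup`, `Blowup.isMinimalSet`, `exists_strictlyErgodicSet`). Collapsing the gaps is
one-to-one off a null set, so unique ergodicity of the rotation passes to the coded set, whose
measure is the image of Lebesgue measure. Equidistribution gives frequency `t`.

Fixing the sum of the `n + 1` lengths leaves `n` free parameters. The coded set determines the step
function up to translation (`StepPair.eq_translate_of_code_eq`), and a longest gap between arcs
marks the origin, so the lengths can be recovered (`Admissible.eq_of_translate`). The measure
depends continuously on the lengths by dominated convergence. A continuous injection of a compact
ball into a Hausdorff space is an embedding (`exists_embedded_ball`). -/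

lemma fourier_ne_one_of_addOrderOf_eq_zero {a : UnitAddCircle} (ha : addOrderOf a = 0) {k : ℤ}
    (hk : k ≠ 0) : fourier k a ≠ 1 := by
  intro h
  rw [fourier_apply] at h
  have h1 : AddCircle.toCircle (k • a) = AddCircle.toCircle (0 : UnitAddCircle) := by
    rw [AddCircle.toCircle_zero]
    exact Subtype.ext h
  have h2 := AddCircle.injective_toCircle one_ne_zero h1
  have h3 : ((addOrderOf a : ℕ) : ℤ) ∣ k := addOrderOf_dvd_iff_zsmul_eq_zero.2 h2
  rw [ha] at h3
  exact hk (by simpa using h3)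

lemma fourier_add_arg (k : ℤ) (x y : UnitAddCircle) :
    fourier k (x + y) = fourier k x * fourier k y := by
  simp only [fourier_apply, smul_add, AddCircle.toCircle_add, Circle.coe_mul]

lemma fourier_nsmul_arg (k : ℤ) (i : ℕ) (x : UnitAddCircle) :
    fourier k (i • x) = fourier k x ^ i := by
  induction i with
  | zero => simp
  | succ i ih => rw [succ_nsmul, fourier_add_arg, ih, pow_succ]

/-- Translating by `a` preserves the integral but multiplies it by `fourier k a ≠ 1`. -/
lemma integral_fourier_eq_zero {a : UnitAddCircle} (ha : addOrderOf a = 0) {k : ℤ}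
    (hk : k ≠ 0) : ∫ x : UnitAddCircle, fourier k x = 0 := by
  have h := integral_add_right_eq_self (μ := (volume : Measure UnitAddCircle))
    (fun x => fourier k x) a
  simp only [fourier_add_arg, integral_mul_const] at h
  have h2 := fourier_ne_one_of_addOrderOf_eq_zero ha hk
  have h3 : (∫ x : UnitAddCircle, fourier k x) * (fourier k a - 1) = 0 := by
    rw [mul_sub, h]; ring
  rcases mul_eq_zero.1 h3 with h4 | h4
  · exact h4
  · exact absurd (sub_eq_zero.1 h4) h2

/-- The Birkhoff average of `φ` over the first `N` points of the orbit of `x` under the rotation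
by `a`. -/
def rotationAverage (a x : UnitAddCircle) (N : ℕ) (φ : UnitAddCircle → ℂ) : ℂ :=
  (N : ℂ)⁻¹ * ∑ i ∈ Finset.range N, φ (x + i • a)

/-- For `k ≠ 0` the Birkhoff sums are geometric with ratio `q ≠ 1` of modulus one, hence bounded by
`2 / ‖q - 1‖`. -/
lemma tendsto_rotationAverage_fourier {a : UnitAddCircle} (ha : addOrderOf a = 0)
    (x : UnitAddCircle) (k : ℤ) :
    Tendsto (fun N => rotationAverage a x N (fourier k)) atTop
      (𝓝 (∫ y : UnitAddCircle, fourier k y)) := by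
  rcases eq_or_ne k 0 with rfl | hk
  · have h1 : ∫ y : UnitAddCircle, (fourier 0 y : ℂ) = 1 := by
      simp [Measure.real]
    rw [h1]
    refine (tendsto_const_nhds (x := (1 : ℂ))).congr' ?_
    filter_upwards [eventually_ne_atTop 0] with N hN
    simp only [rotationAverage, fourier_zero]
    simp [hN]
  · rw [integral_fourier_eq_zero ha hk]
    have h2 := fourier_ne_one_of_addOrderOf_eq_zero ha hk
    set q := fourier k a with hq
    have hqn : ‖q‖ = 1 := Circle.norm_coe _
    have h4 : ∀ N : ℕ, ‖rotationAverage a x N (fourier k)‖ ≤ (N : ℝ)⁻¹ * (2 / ‖q - 1‖) := by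
      intro N
      simp only [rotationAverage, fourier_add_arg, fourier_nsmul_arg, ← Finset.mul_sum, ← hq]
      rw [geom_sum_eq h2, norm_mul, norm_mul, norm_div, norm_inv]
      have h5 : ‖fourier k x‖ = 1 := Circle.norm_coe _
      rw [h5, one_mul]
      have h6 : ‖q ^ N - 1‖ ≤ 2 := by
        refine (norm_sub_le _ _).trans ?_
        rw [norm_pow, hqn]; norm_num
      simp only [Complex.norm_natCast]
      gcongr
    refine squeeze_zero_norm h4 ?_
    have := (tendsto_inv_atTop_zero.comp (tendsto_natCast_atTop_atTop (R := ℝ))).mul_const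
      (2 / ‖q - 1‖)
    simpa using this

lemma rotationAverage_add (a x : UnitAddCircle) (N : ℕ) (φ ψ : UnitAddCircle → ℂ) :
    rotationAverage a x N (fun y => φ y + ψ y) =
      rotationAverage a x N φ + rotationAverage a x N ψ := by
  simp [rotationAverage, Finset.sum_add_distrib, mul_add]

lemma rotationAverage_const_mul (a x : UnitAddCircle) (N : ℕ) (c : ℂ) (φ : UnitAddCircle → ℂ) :
    rotationAverage a x N (fun y => c * φ y) = c * rotationAverage a x N φ := by
  simp only [rotationAverage, ← Finset.mul_sum]; ring

lemma norm_rotationAverage_le (a x : UnitAddCircle) (N : ℕ) {φ : UnitAddCircle → ℂ} {C : ℝ}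
    (hC : 0 ≤ C) (h : ∀ y, ‖φ y‖ ≤ C) : ‖rotationAverage a x N φ‖ ≤ C := by
  rcases eq_or_ne N 0 with rfl | hN
  · simpa [rotationAverage] using hC
  · rw [rotationAverage, norm_mul, norm_inv, Complex.norm_natCast]
    have h1 : ‖∑ i ∈ Finset.range N, φ (x + i • a)‖ ≤ N * C := by
      refine (norm_sum_le_of_le _ fun i _ => h _).trans ?_
      simp
    have h2 : (0 : ℝ) < N := by positivity
    calc (N : ℝ)⁻¹ * _ ≤ (N : ℝ)⁻¹ * (N * C) := by gcongr
      _ = C := by field_simp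

lemma integrable_continuousMap_circle (φ : C(UnitAddCircle, ℂ)) :
    Integrable φ (volume : Measure UnitAddCircle) :=
  φ.continuous.integrable_of_hasCompactSupport (HasCompactSupport.of_compactSpace _)

/-- Weyl equidistribution for continuous functions. -/
theorem tendsto_rotationAverage {a : UnitAddCircle} (ha : addOrderOf a = 0) (x : UnitAddCircle)
    (φ : C(UnitAddCircle, ℂ)) :
    Tendsto (fun N => rotationAverage a x N φ) atTop (𝓝 (∫ y : UnitAddCircle, φ y)) := by
  have hspan : ∀ ψ ∈ Submodule.span ℂ (Set.range (@fourier 1)),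
      Tendsto (fun N => rotationAverage a x N ψ) atTop (𝓝 (∫ y : UnitAddCircle, ψ y)) := by
    intro ψ hψ
    induction hψ using Submodule.span_induction with
    | mem ψ h =>
      obtain ⟨k, rfl⟩ := h
      exact tendsto_rotationAverage_fourier ha x k
    | zero => simp [rotationAverage]
    | add u v _ _ hu hv =>
      have h1 : ∫ y : UnitAddCircle, (u + v) y = (∫ y, u y) + ∫ y, v y :=
        integral_add (integrable_continuousMap_circle u) (integrable_continuousMap_circle v)
      rw [h1]
      exact (hu.add hv).congr fun N => (rotationAverage_add a x N u v).symm
    | smul c u _ hu =>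
      have h1 : ∫ y : UnitAddCircle, (c • u) y = c * ∫ y, u y := integral_const_mul c u
      rw [h1]
      exact (hu.const_mul c).congr fun N => (rotationAverage_const_mul a x N c u).symm
  rw [Metric.tendsto_atTop]
  intro ε hε
  -- Trigonometric polynomials are uniformly dense, and both averages and integrals are 1-Lipschitz
  -- for the sup norm.
  have hmem : φ ∈ closure (Submodule.span ℂ (Set.range (@fourier 1)) : Set C(UnitAddCircle, ℂ)) := by
    have := span_fourier_closure_eq_top (T := 1)
    rw [← Submodule.topologicalClosure_coe, this]
    trivial
  obtain ⟨ψ, hψ, hd⟩ := Metric.mem_closure_iff.1 hmem (ε / 3) (by positivity)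
  obtain ⟨N₀, hN₀⟩ := Metric.tendsto_atTop.1 (hspan ψ hψ) (ε / 3) (by positivity)
  refine ⟨N₀, fun N hN => ?_⟩
  have hpt : ∀ y, ‖φ y - ψ y‖ ≤ ‖φ - ψ‖ := fun y => (φ - ψ).norm_coe_le_norm y
  rw [dist_eq_norm] at hd
  have h1 : ‖rotationAverage a x N φ - rotationAverage a x N ψ‖ ≤ ‖φ - ψ‖ := by
    have h2 := rotationAverage_add a x N (fun y => φ y - ψ y) ψ
    simp only [sub_add_cancel] at h2
    rw [show rotationAverage a x N φ - rotationAverage a x N ψ =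
      rotationAverage a x N (fun y => φ y - ψ y) from sub_eq_of_eq_add h2]
    exact norm_rotationAverage_le a x N (norm_nonneg _) hpt
  have h3 : ‖(∫ y : UnitAddCircle, ψ y) - ∫ y : UnitAddCircle, φ y‖ ≤ ‖φ - ψ‖ := by
    rw [← integral_sub (integrable_continuousMap_circle ψ) (integrable_continuousMap_circle φ)]
    refine (norm_integral_le_of_norm_le_const (C := ‖φ - ψ‖)
      (Eventually.of_forall fun y => ?_)).trans ?_
    · rw [norm_sub_rev]; exact hpt y
    · simp [Measure.real]
  have h4 := hN₀ N hN
  rw [dist_eq_norm] at h4 ⊢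
  calc _ = ‖(rotationAverage a x N φ - rotationAverage a x N ψ) +
        (rotationAverage a x N ψ - ∫ y : UnitAddCircle, ψ y) +
        ((∫ y : UnitAddCircle, ψ y) - ∫ y : UnitAddCircle, φ y)‖ := by congr 1; ring
    _ ≤ _ := norm_add₃_le
    _ < ε := by linarith

/-- An irrational rotation is uniquely ergodic. -/
theorem eq_volume_of_map_add {a : UnitAddCircle} (ha : addOrderOf a = 0)
    (ν : Measure UnitAddCircle) [IsProbabilityMeasure ν] (hν : ν.map (· + a) = ν) :
    ν = volume := by
  have hiter : ∀ (φ : C(UnitAddCircle, ℂ)) (i : ℕ), ∫ y, φ (y + i • a) ∂ν = ∫ y, φ y ∂ν := by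
    intro φ i
    induction i with
    | zero => simp
    | succ i ih =>
      rw [← ih]
      have h := integral_map (μ := ν) (φ := (· + a)) (by fun_prop)
        (f := fun y => φ (y + i • a)) (by
          exact (φ.continuous.comp (continuous_add_const _)).aestronglyMeasurable)
      rw [hν] at h
      rw [h]
      congr 1; ext y; congr 1; rw [succ_nsmul]; abel
  have hint : ∀ (φ : C(UnitAddCircle, ℂ)), Integrable φ ν := fun φ =>
    φ.continuous.integrable_of_hasCompactSupport (HasCompactSupport.of_compactSpace _)
  have hC : ∀ φ : C(UnitAddCircle, ℂ), ∫ y, φ y ∂ν = ∫ y : UnitAddCircle, φ y := by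
    intro φ
    -- Averaging along orbits does not change the `ν`-integral, while the averages converge
    -- pointwise to the Lebesgue integral.
    have hav : ∀ N : ℕ, N ≠ 0 → ∫ y, rotationAverage a y N φ ∂ν = ∫ y, φ y ∂ν := by
      intro N hN
      simp only [rotationAverage]
      rw [integral_const_mul, integral_finsetSum]
      · rw [Finset.sum_congr rfl fun i _ => hiter φ i]
        rw [Finset.sum_const, Finset.card_range, nsmul_eq_mul]
        have : (N : ℂ) ≠ 0 := by exact_mod_cast hN
        field_simp
      · intro i _
        exact hint (φ.comp ⟨fun y => y + i • a, by fun_prop⟩)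
    have hlim : Tendsto (fun N : ℕ => ∫ y, rotationAverage a y N φ ∂ν) atTop
        (𝓝 (∫ _, (∫ z : UnitAddCircle, φ z) ∂ν)) := by
      refine tendsto_integral_of_dominated_convergence (fun _ => ‖φ‖) (fun N => ?_)
        (integrable_const _) (fun N => ?_) ?_
      · apply Continuous.aestronglyMeasurable
        unfold rotationAverage
        fun_prop
      · exact Eventually.of_forall fun y =>
          norm_rotationAverage_le a y N (norm_nonneg _) fun z => φ.norm_coe_le_norm z
      · exact Eventually.of_forall fun y => tendsto_rotationAverage ha y φ
    rw [integral_const, probReal_univ, one_smul] at hlim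
    refine tendsto_nhds_unique (tendsto_const_nhds.congr' ?_) hlim
    filter_upwards [eventually_ne_atTop 0] with N hN
    exact (hav N hN).symm
  apply ext_of_forall_integral_eq_of_IsFiniteMeasure
  intro f
  have h := hC ⟨fun y => (f y : ℂ), by fun_prop⟩
  simp only [ContinuousMap.coe_mk, integral_complex_ofReal] at h
  exact_mod_cast h

/-- The empirical measure of the first `N + 1` points of an orbit of the rotation by `a`. -/
def rotationEmpirical (a x : UnitAddCircle) (N : ℕ) : ProbabilityMeasure UnitAddCircle :=
  ⟨((N : ENNReal) + 1)⁻¹ • ∑ i ∈ Finset.range (N + 1), Measure.dirac (x + i • a), ⟨by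
    simp only [Measure.smul_apply, Measure.coe_finsetSum, Finset.sum_apply, measure_univ,
      Finset.sum_const, Finset.card_range, nsmul_eq_mul, mul_one, smul_eq_mul]
    push_cast
    exact ENNReal.inv_mul_cancel (by simp) (by simp)⟩⟩

/-- Lebesgue measure on the circle as a probability measure. -/
def circleVolume : ProbabilityMeasure UnitAddCircle := ⟨volume, ⟨UnitAddCircle.measure_univ⟩⟩

theorem tendsto_rotationEmpirical {a : UnitAddCircle} (ha : addOrderOf a = 0)
    (x : UnitAddCircle) : Tendsto (rotationEmpirical a x) atTop (𝓝 circleVolume) := by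
  rw [ProbabilityMeasure.tendsto_iff_forall_integral_tendsto]
  intro f
  have h := (tendsto_rotationAverage ha x ⟨fun y => (f y : ℂ), by fun_prop⟩).comp
    (tendsto_add_atTop_nat 1)
  simp only [ContinuousMap.coe_mk, integral_complex_ofReal] at h
  have h2 := (Complex.continuous_re.tendsto _).comp h
  refine h2.congr fun N => ?_
  have h3 : ∫ y, f y ∂(rotationEmpirical a x N : Measure UnitAddCircle) =
      ((N : ℝ) + 1)⁻¹ * ∑ i ∈ Finset.range (N + 1), f (x + i • a) := by
    simp only [rotationEmpirical, ProbabilityMeasure.coe_mk]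
    rw [integral_smul_measure, integral_finsetSum_measure]
    · simp only [integral_dirac, smul_eq_mul]
      congr 1
      rw [ENNReal.toReal_inv, ENNReal.toReal_add (by simp) (by simp)]
      simp
    · intro i _
      exact f.integrable _
  rw [h3]
  simp only [Function.comp, rotationAverage]
  rw [show (((N + 1 : ℕ) : ℂ)⁻¹ * ∑ i ∈ Finset.range (N + 1), ((f (x + i • a) : ℝ) : ℂ)) =
    (((((N : ℝ) + 1)⁻¹ * ∑ i ∈ Finset.range (N + 1), f (x + i • a) : ℝ)) : ℂ) by push_cast; rfl]
  exact Complex.ofReal_re _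

/-- Visits of an orbit of an irrational rotation to a set with null frontier have frequency equal
to its measure. -/
theorem tendsto_visit_frequency {a : UnitAddCircle} (ha : addOrderOf a = 0) (x : UnitAddCircle)
    {U : Set UnitAddCircle} (hU : MeasurableSet U) (hfr : volume (frontier U) = 0) :
    Tendsto (fun N : ℕ =>
      (∑ i ∈ Finset.range (N + 1), U.indicator (fun _ => (1 : ℝ)) (x + i • a)) / ((N : ℝ) + 1))
      atTop (𝓝 (volume.real U)) := by
  have h := ProbabilityMeasure.tendsto_measure_of_null_frontier_of_tendsto
    (tendsto_rotationEmpirical ha x) (E := U) (by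
      rw [ProbabilityMeasure.null_iff_toMeasure_null]; exact hfr)
  have h2 := (NNReal.continuous_coe.tendsto _).comp h
  refine h2.congr fun N => ?_
  simp only [Function.comp]
  rw [← ProbabilityMeasure.measureReal_eq_coe_coeFn]
  simp only [rotationEmpirical, ProbabilityMeasure.coe_mk, Measure.real, Measure.smul_apply,
    Measure.coe_finsetSum, Finset.sum_apply, smul_eq_mul, ENNReal.toReal_mul]
  rw [ENNReal.toReal_sum (fun i _ => measure_ne_top _ _), div_eq_inv_mul, ENNReal.toReal_inv,
    ENNReal.toReal_add (by simp) (by simp)]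
  simp only [ENNReal.toReal_natCast, ENNReal.toReal_one]
  congr 1
  refine Finset.sum_congr rfl fun i _ => ?_
  rw [Measure.dirac_apply' _ hU]
  by_cases hm : x + i • a ∈ U <;> simp [hm]

lemma addOrderOf_coe_of_irrational {α : ℝ} (hα : Irrational α) :
    addOrderOf (α : UnitAddCircle) = 0 := by
  rw [← AddCircle.denseRange_zsmul_iff, AddCircle.denseRange_zsmul_coe_iff]
  simpa using hα

/-- The numbers `i α + k` are dense. -/
lemma exists_zmul_add_int_mem_Ioo {α : ℝ} (hα : Irrational α) {b c : ℝ} (h : b < c) :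
    ∃ i k : ℤ, (i : ℝ) * α + k ∈ Set.Ioo b c := by
  have hd : Dense (AddSubgroup.closure {α, 1} : Set ℝ) :=
    dense_addSubgroupClosure_pair_iff.2 (by simpa using hα)
  obtain ⟨x, hx, hm⟩ := hd.exists_between h
  obtain ⟨i, k, rfl⟩ := AddSubgroup.mem_closure_pair.1 hx
  exact ⟨i, k, by simpa using hm⟩

/-! ### Circle maps induced by maps of the line -/

lemma isQuotientMap_coe_circle : Topology.IsQuotientMap ((↑) : ℝ → UnitAddCircle) :=
  QuotientAddGroup.isOpenQuotientMap_mk.isQuotientMap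

lemma coe_circle_eq_iff {x y : ℝ} : (x : UnitAddCircle) = y ↔ ∃ k : ℤ, x = y + k := by
  rw [← sub_eq_zero, ← AddCircle.coe_sub, AddCircle.coe_eq_zero_iff]
  constructor
  · rintro ⟨k, hk⟩
    exact ⟨k, by simp at hk; linarith⟩
  · rintro ⟨k, hk⟩
    exact ⟨k, by simp; linarith⟩

lemma coe_circle_add_int (x : ℝ) (k : ℤ) : ((x + k : ℝ) : UnitAddCircle) = x :=
  coe_circle_eq_iff.2 ⟨k, rfl⟩

/-- The map of the circle induced by a `1`-periodic function on the line. -/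
def circleLift {β : Type*} (u : ℝ → β) (hu : Function.Periodic u 1) : UnitAddCircle → β :=
  hu.lift

@[simp]
lemma circleLift_coe {β : Type*} (u : ℝ → β) (hu : Function.Periodic u 1) (x : ℝ) :
    circleLift u hu (x : UnitAddCircle) = u x := rfl

lemma continuous_circleLift {β : Type*} [TopologicalSpace β] {u : ℝ → β}
    (hu : Function.Periodic u 1) (hc : Continuous u) : Continuous (circleLift u hu) :=
  isQuotientMap_coe_circle.continuous_iff.2 hc

/-- Itineraries are discontinuous, so instead of the quotient topology the measurable identification
of the circle with `[0, 1)` is used. -/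
lemma measurable_circleLift {β : Type*} [MeasurableSpace β] {u : ℝ → β}
    (hu : Function.Periodic u 1) (hm : Measurable u) : Measurable (circleLift u hu) := by
  have h : circleLift u hu = fun z => u (AddCircle.measurableEquivIco 1 0 z : ℝ) := by
    ext z
    conv_lhs => rw [← (AddCircle.measurableEquivIco 1 0).symm_apply_apply z]
    rfl
  rw [h]
  exact hm.comp (measurable_subtype_coe.comp (AddCircle.measurableEquivIco 1 0).measurable)

lemma periodic_coe_of_map_add_one {u : ℝ → ℝ} (hu : ∀ x, u (x + 1) = u x + 1) :
    Function.Periodic (fun x => (u x : UnitAddCircle)) 1 := fun x => by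
  simp only [hu]
  exact AddCircle.coe_add_period 1 (u x)

lemma map_add_int_of_map_add_one {u : ℝ → ℝ} (hu : ∀ x, u (x + 1) = u x + 1) (x : ℝ) (k : ℤ) :
    u (x + k) = u x + k := by
  induction k with
  | zero => simp
  | succ i ih =>
    push_cast at ih ⊢
    rw [← add_assoc, hu, ih, add_assoc]
  | pred i ih =>
    push_cast at ih ⊢
    have h := hu (x + (-(i : ℝ) - 1))
    rw [show x + (-(i : ℝ) - 1) + 1 = x + -i by ring, ih] at h
    linarith

/-! ### Blow-ups of the line -/

/-- A periodic way of replacing each point `x` of the line by an interval `[L x, R x]`. -/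
structure Blowup where
  L : ℝ → ℝ
  R : ℝ → ℝ
  le : ∀ x, L x ≤ R x
  lt : ∀ x x', x < x' → R x < L x'
  L_add_one : ∀ x, L (x + 1) = L x + 1
  R_add_one : ∀ x, R (x + 1) = R x + 1
  cover : ∀ y, ∃ x, L x ≤ y ∧ y ≤ R x

namespace Blowup

variable (B : Blowup)

/-- The monotone map collapsing each interval `[L x, R x]` to `x`. -/
def h (y : ℝ) : ℝ := (B.cover y).choose

lemma L_h_le (y : ℝ) : B.L (B.h y) ≤ y := (B.cover y).choose_spec.1

lemma le_R_h (y : ℝ) : y ≤ B.R (B.h y) := (B.cover y).choose_spec.2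

variable {B}

lemma h_eq {x y : ℝ} (h1 : B.L x ≤ y) (h2 : y ≤ B.R x) : B.h y = x := by
  rcases lt_trichotomy (B.h y) x with h | h | h
  · have := B.lt _ _ h; have := B.le_R_h y; linarith
  · exact h
  · have := B.lt _ _ h; have := B.L_h_le y; linarith

@[simp] lemma h_L (x : ℝ) : B.h (B.L x) = x := h_eq le_rfl (B.le x)

@[simp] lemma h_R (x : ℝ) : B.h (B.R x) = x := h_eq (B.le x) le_rfl

lemma h_mono : Monotone B.h := by
  intro y y' hy
  by_contra hc
  have := B.lt _ _ (not_le.1 hc)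
  have := B.L_h_le y; have := B.le_R_h y'
  linarith

lemma continuous_h : Continuous B.h :=
  h_mono.continuous_of_surjective fun x => ⟨B.L x, h_L x⟩

lemma h_add_one (y : ℝ) : B.h (y + 1) = B.h y + 1 :=
  h_eq (by rw [B.L_add_one]; linarith [B.L_h_le y]) (by rw [B.R_add_one]; linarith [B.le_R_h y])

variable (B) in
/-- Translation by `a` permutes the intervals that are not reduced to a point. -/
def Invariant (a : ℝ) : Prop := ∀ x, B.L x = B.R x ↔ B.L (x + a) = B.R (x + a)

lemma Invariant.neg {a : ℝ} (ha : B.Invariant a) : B.Invariant (-a) := fun x => by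
  have := ha (x + -a)
  rw [neg_add_cancel_right] at this
  exact this.symm

variable (B) in
/-- The map of the line carrying each interval `[L x, R x]` affinely to `[L (x + a), R (x + a)]`. -/
def G (a y : ℝ) : ℝ :=
  B.L (B.h y + a) + (y - B.L (B.h y)) / (B.R (B.h y) - B.L (B.h y)) *
    (B.R (B.h y + a) - B.L (B.h y + a))

lemma ratio_mem (y : ℝ) :
    (y - B.L (B.h y)) / (B.R (B.h y) - B.L (B.h y)) ∈ Set.Icc (0 : ℝ) 1 := by
  have h1 := B.L_h_le y
  have h2 := B.le_R_h y
  exact ⟨div_nonneg (by linarith) (by linarith), div_le_one_of_le₀ (by linarith) (by linarith)⟩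

lemma L_le_G (a y : ℝ) : B.L (B.h y + a) ≤ B.G a y := by
  have := mul_nonneg (ratio_mem (B := B) y).1 (sub_nonneg.2 (B.le (B.h y + a)))
  unfold G; linarith

lemma G_le_R (a y : ℝ) : B.G a y ≤ B.R (B.h y + a) := by
  have := mul_le_mul_of_nonneg_right (ratio_mem (B := B) y).2 (sub_nonneg.2 (B.le (B.h y + a)))
  unfold G; linarith

@[simp] lemma h_G (a y : ℝ) : B.h (B.G a y) = B.h y + a := h_eq (L_le_G a y) (G_le_R a y)

lemma G_L (a x : ℝ) : B.G a (B.L x) = B.L (x + a) := by simp [G]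

lemma G_R {a : ℝ} (ha : B.Invariant a) (x : ℝ) : B.G a (B.R x) = B.R (x + a) := by
  -- On a degenerate interval the ratio in `G` is `0 / 0 = 0`, so `G` returns the left end;
  -- invariance makes the target interval degenerate too.
  rcases eq_or_ne (B.L x) (B.R x) with h | h
  · rw [← h, G_L, (ha x).1 h]
  · have : B.R x - B.L x ≠ 0 := sub_ne_zero.2 h.symm
    simp [G, div_self this]

lemma G_neg_G {a : ℝ} (ha : B.Invariant a) (y : ℝ) : B.G (-a) (B.G a y) = y := by
  have h1 := B.L_h_le y
  have h2 := B.le_R_h y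
  rw [G, h_G, add_neg_cancel_right]
  rcases eq_or_ne (B.L (B.h y)) (B.R (B.h y)) with h | h
  · rw [← h]; simp; linarith
  · have e1 : B.R (B.h y) - B.L (B.h y) ≠ 0 := sub_ne_zero.2 h.symm
    have e2 : B.R (B.h y + a) - B.L (B.h y + a) ≠ 0 :=
      sub_ne_zero.2 fun e => h ((ha _).2 e.symm)
    unfold G
    field_simp
    ring

lemma G_mono (a : ℝ) : Monotone (B.G a) := by
  intro y y' hy
  rcases (B.h_mono hy).lt_or_eq with h | h
  · exact ((G_le_R a y).trans (B.lt _ _ (by linarith)).le).trans (L_le_G a y')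
  · unfold G
    rw [h]
    have h1 := sub_nonneg.2 (B.le (B.h y'))
    have h2 := sub_nonneg.2 (B.le (B.h y' + a))
    gcongr

lemma continuous_G {a : ℝ} (ha : B.Invariant a) : Continuous (B.G a) :=
  (G_mono a).continuous_of_surjective fun y => ⟨B.G (-a) y, by
    simpa using G_neg_G ha.neg y⟩

lemma G_add_one (a y : ℝ) : B.G a (y + 1) = B.G a y + 1 := by
  simp only [G, h_add_one, add_right_comm _ (1 : ℝ) a, B.L_add_one, B.R_add_one]
  ring_nf

/-- The circle homeomorphism induced by `G a`. -/
def circleHomeo {a : ℝ} (ha : B.Invariant a) : UnitAddCircle ≃ₜ UnitAddCircle where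
  toFun := circleLift _ (periodic_coe_of_map_add_one (G_add_one (B := B) a))
  invFun := circleLift _ (periodic_coe_of_map_add_one (G_add_one (B := B) (-a)))
  left_inv z := by
    induction z using QuotientAddGroup.induction_on with
    | H y => simp only [circleLift_coe, G_neg_G ha]
  right_inv z := by
    induction z using QuotientAddGroup.induction_on with
    | H y =>
      have := G_neg_G ha.neg y
      rw [neg_neg] at this
      simp only [circleLift_coe, this]
  continuous_toFun := continuous_circleLift _
    ((AddCircle.continuous_mk' 1).comp (continuous_G ha))
  continuous_invFun := continuous_circleLift _
    ((AddCircle.continuous_mk' 1).comp (continuous_G ha.neg))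

/-- The collapsing map `h` semiconjugates `G a` to translation by `a`, and translation numbers are
invariant under such semiconjugacies. -/
lemma hasCircleRotationNumber {a : ℝ} (ha : B.Invariant a) :
    HasCircleRotationNumber (circleHomeo ha) (a : UnitAddCircle) := by
  let Gl : CircleDeg1Lift := ⟨⟨B.G a, G_mono a⟩, G_add_one a⟩
  let hl : CircleDeg1Lift := ⟨⟨B.h, h_mono⟩, h_add_one⟩
  refine ⟨Gl, fun x => rfl, ?_⟩
  congr 1
  have hs : Function.Semiconj hl Gl (CircleDeg1Lift.translate (Multiplicative.ofAdd a)) := by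
    intro y
    rw [CircleDeg1Lift.translate_apply, add_comm]
    exact h_G a y
  rw [CircleDeg1Lift.translationNumber_eq_of_semiconj hs]
  exact CircleDeg1Lift.translationNumber_translate a

/-! ### The minimal set of a blow-up -/

variable (B) in
/-- The endpoints of the intervals of the blow-up. -/
def endpoints : Set ℝ := {y | y = B.L (B.h y) ∨ y = B.R (B.h y)}

lemma L_mem_endpoints (x : ℝ) : B.L x ∈ B.endpoints := Or.inl (by simp)

lemma R_mem_endpoints (x : ℝ) : B.R x ∈ B.endpoints := Or.inr (by simp)

lemma isClosed_endpoints : IsClosed B.endpoints := by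
  have : B.endpoints = (⋃ x, Set.Ioo (B.L x) (B.R x))ᶜ := by
    ext y
    simp only [endpoints, Set.mem_ofPred_eq, Set.mem_compl_iff, Set.mem_iUnion, not_exists]
    constructor
    · rintro h x ⟨h1, h2⟩
      have := h_eq h1.le h2.le
      rw [this] at h
      rcases h with h | h <;> linarith
    · intro h
      by_contra hc
      push Not at hc
      exact h (B.h y) ⟨lt_of_le_of_ne (B.L_h_le y) hc.1.symm, lt_of_le_of_ne (B.le_R_h y) hc.2⟩
  rw [this]
  exact (isOpen_iUnion fun x => isOpen_Ioo).isClosed_compl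

lemma endpoints_add_int {y : ℝ} (k : ℤ) : y + k ∈ B.endpoints ↔ y ∈ B.endpoints := by
  simp only [endpoints, Set.mem_ofPred_eq, map_add_int_of_map_add_one B.h_add_one,
    map_add_int_of_map_add_one B.L_add_one, map_add_int_of_map_add_one B.R_add_one,
    add_left_inj]

variable (B) in
/-- The minimal set, as a subset of the circle. -/
def minimalSet : Set UnitAddCircle := (↑) '' B.endpoints

lemma coe_mem_minimalSet {y : ℝ} : (y : UnitAddCircle) ∈ B.minimalSet ↔ y ∈ B.endpoints := by
  constructor
  · rintro ⟨y', hy', h⟩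
    obtain ⟨k, rfl⟩ := coe_circle_eq_iff.1 h
    exact (endpoints_add_int k).1 hy'
  · exact fun h => ⟨y, h, rfl⟩

lemma isClosed_minimalSet : IsClosed B.minimalSet := by
  rw [← isQuotientMap_coe_circle.isClosed_preimage]
  convert B.isClosed_endpoints using 1
  ext y
  exact coe_mem_minimalSet

lemma G_mem_endpoints {a : ℝ} (ha : B.Invariant a) {y : ℝ} (hy : y ∈ B.endpoints) :
    B.G a y ∈ B.endpoints := by
  rcases hy with h | h
  · rw [h, G_L]; exact L_mem_endpoints _
  · rw [h, G_R ha]; exact R_mem_endpoints _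

lemma circleHomeo_mem {a : ℝ} (ha : B.Invariant a) {z : UnitAddCircle} (hz : z ∈ B.minimalSet) :
    circleHomeo ha z ∈ B.minimalSet := by
  obtain ⟨y, hy, rfl⟩ := hz
  exact coe_mem_minimalSet.2 (G_mem_endpoints ha hy)

lemma circleHomeo_symm_mem {a : ℝ} (ha : B.Invariant a) {z : UnitAddCircle}
    (hz : z ∈ B.minimalSet) : (circleHomeo ha).symm z ∈ B.minimalSet := by
  obtain ⟨y, hy, rfl⟩ := hz
  exact coe_mem_minimalSet.2 (G_mem_endpoints ha.neg hy)

lemma image_minimalSet {a : ℝ} (ha : B.Invariant a) :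
    circleHomeo ha '' B.minimalSet = B.minimalSet := by
  apply Set.Subset.antisymm
  · rintro _ ⟨z, hz, rfl⟩
    exact circleHomeo_mem ha hz
  · intro z hz
    exact ⟨_, circleHomeo_symm_mem ha hz, by simp⟩

lemma circleHomeo_zpow_mem {a : ℝ} (ha : B.Invariant a) {z : UnitAddCircle}
    (hz : z ∈ B.minimalSet) (i : ℤ) : (circleHomeo ha ^ i) z ∈ B.minimalSet := by
  induction i with
  | zero => simpa using hz
  | succ i ih =>
    rw [add_comm, zpow_add, zpow_one]
    exact circleHomeo_mem ha ih
  | pred i ih =>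
    rw [sub_eq_neg_add, zpow_add, zpow_neg_one]
    exact circleHomeo_symm_mem ha ih

lemma exists_circleHomeo_zpow_eq {a : ℝ} (ha : B.Invariant a) (y : ℝ) (i : ℤ) :
    ∃ y' : ℝ, (circleHomeo ha ^ i) (y : UnitAddCircle) = y' ∧ B.h y' = B.h y + i * a := by
  induction i with
  | zero => exact ⟨y, by simp⟩
  | succ i ih =>
    obtain ⟨y', h1, h2⟩ := ih
    refine ⟨B.G a y', ?_, ?_⟩
    · rw [add_comm, zpow_add, zpow_one]
      exact congrArg (circleHomeo ha) h1
    · rw [h_G, h2]; push_cast; ring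
  | pred i ih =>
    obtain ⟨y', h1, h2⟩ := ih
    refine ⟨B.G (-a) y', ?_, ?_⟩
    · rw [sub_eq_neg_add, zpow_add, zpow_neg_one]
      exact congrArg (circleHomeo ha).symm h1
    · rw [h_G, h2]; push_cast; ring

lemma exists_lt_of_lt_L {x y : ℝ} (hy : y < B.L x) : ∃ x' < x, y < B.L x' := by
  have h1 : B.h y < x := by
    by_contra hc
    have h2 := B.L_h_le y
    rcases (not_lt.1 hc).eq_or_lt with h | h
    · rw [← h] at h2; linarith
    · linarith [B.lt _ _ h, B.le x]
  obtain ⟨x', h2, h3⟩ := exists_between h1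
  exact ⟨x', h3, (B.le_R_h y).trans_lt (B.lt _ _ h2)⟩

lemma exists_gt_of_R_lt {x y : ℝ} (hy : B.R x < y) : ∃ x' > x, B.R x' < y := by
  have h1 : x < B.h y := by
    by_contra hc
    have h2 := B.le_R_h y
    rcases (not_lt.1 hc).eq_or_lt with h | h
    · rw [h] at h2; linarith
    · linarith [B.lt _ _ h, B.le x]
  obtain ⟨x', h2, h3⟩ := exists_between h1
  exact ⟨x', h2, (B.lt _ _ h3).trans_le (B.L_h_le y)⟩

/-- An endpoint is accumulated by other blown-up intervals from the side away from its own gap. To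
enter `V` it then suffices that the collapsed point lies in `(x₁, x₂)`. -/
lemma exists_lt_of_mem_nhds_endpoint {y : ℝ} (hy : y ∈ B.endpoints) {V : Set ℝ} (hV : V ∈ 𝓝 y) :
    ∃ x₁ x₂, x₁ < x₂ ∧ Set.Ioo (B.R x₁) (B.L x₂) ⊆ V := by
  obtain ⟨l, u, hm, hs⟩ := mem_nhds_iff_exists_Ioo_subset.1 hV
  rcases hy with h | h
  · obtain ⟨x', h1, h2⟩ := exists_lt_of_lt_L (hm.1.trans_eq h)
    refine ⟨x', B.h y, h1, fun w hw => hs ⟨?_, ?_⟩⟩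
    · linarith [hw.1, B.le x']
    · linarith [hw.2, hm.2]
  · obtain ⟨x', h1, h2⟩ := exists_gt_of_R_lt (h.symm.trans_lt hm.2)
    refine ⟨B.h y, x', h1, fun w hw => hs ⟨?_, ?_⟩⟩
    · linarith [hw.1, hm.1]
    · linarith [hw.2, B.le x']

/-- After collapsing, orbits are those of translation by `α` modulo integers, which are dense. -/
theorem isMinimalSet {α : ℝ} (hα : Irrational α) (ha : B.Invariant α) :
    IsMinimalSet (circleHomeo ha) B.minimalSet := by
  refine ⟨⟨_, B.L 0, L_mem_endpoints 0, rfl⟩, isClosed_minimalSet.isCompact,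
    image_minimalSet ha, ?_⟩
  rintro _ ⟨y, hy, rfl⟩ _ ⟨y', hy', rfl⟩
  rw [mem_closure_iff_nhds]
  intro V hV
  obtain ⟨x₁, x₂, h12, hsub⟩ := exists_lt_of_mem_nhds_endpoint hy'
    ((AddCircle.continuous_mk' (1 : ℝ)).continuousAt.preimage_mem_nhds hV)
  obtain ⟨i, k, hik⟩ := exists_zmul_add_int_mem_Ioo hα
    (show x₁ - B.h y < x₂ - B.h y by linarith)
  obtain ⟨w, hw1, hw2⟩ := exists_circleHomeo_zpow_eq ha y i
  refine ⟨(w : UnitAddCircle), ?_, ⟨i, hw1⟩⟩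
  rw [← coe_circle_add_int w k]
  apply hsub
  have hk : B.h (w + k) = B.h y + i * α + k := by
    rw [map_add_int_of_map_add_one B.h_add_one, hw2]
  have h1 := B.L_h_le (w + k)
  have h2 := B.le_R_h (w + k)
  have h3 := B.lt x₁ (B.h (w + k)) (by rw [hk]; linarith [hik.1])
  have h4 := B.lt (B.h (w + k)) x₂ (by rw [hk]; linarith [hik.2])
  constructor <;> linarith

/-- The orbit of a gap end stays in the closed set `minimalSet`, so it never accumulates inside a
gap. -/
theorem isDenjoyExample {α : ℝ} (hα : Irrational α) (ha : B.Invariant α)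
    (hgap : ∃ x, B.L x ≠ B.R x) : IsDenjoyExample (circleHomeo ha) α := by
  refine ⟨hα, hasCircleRotationNumber ha, fun hmin => ?_⟩
  obtain ⟨x, hx⟩ := hgap
  have hlt := lt_of_le_of_ne (B.le x) hx
  obtain ⟨y, hy1, hy2⟩ := exists_between hlt
  have hy : (y : UnitAddCircle) ∈ B.minimalSet := by
    have h1 := hmin.2.2.2 (B.L x : UnitAddCircle) trivial (Set.mem_univ (y : UnitAddCircle))
    refine closure_minimal ?_ isClosed_minimalSet h1
    rintro _ ⟨i, rfl⟩
    exact circleHomeo_zpow_mem ha (coe_mem_minimalSet.2 (L_mem_endpoints x)) i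
  have h2 := coe_mem_minimalSet.1 hy
  have h3 : B.h y = x := h_eq hy1.le hy2.le
  rcases h2 with h | h <;> rw [h3] at h <;> linarith

end Blowup

/-! ### One-sided behaviour of floor and ceiling -/

lemma eventually_right_floor_ceil (x a : ℝ) :
    ∀ᶠ x' in 𝓝[>] x, ⌊x' - a⌋ = ⌊x - a⌋ ∧ ⌈x' - a⌉ = ⌊x - a⌋ + 1 := by
  have h : Tendsto (fun x' => x' - a) (𝓝[>] x) (𝓝[>] (x - a)) :=
    tendsto_nhdsWithin_iff.2 ⟨(Continuous.tendsto (by fun_prop) x).mono_left nhdsWithin_le_nhds,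
      eventually_nhdsWithin_of_forall fun y hy => sub_lt_sub_right (Set.mem_Ioi.1 hy) a⟩
  have h1 := tendsto_pure.1 ((tendsto_floor_right_pure_floor (x - a)).comp
    (h.mono_right (nhdsWithin_mono _ Set.Ioi_subset_Ici_self)))
  have h2 := tendsto_pure.1 ((tendsto_ceil_right_pure_floor_add_one (x - a)).comp h)
  exact h1.and h2

lemma eventually_left_floor_ceil (x a : ℝ) :
    ∀ᶠ x' in 𝓝[<] x, ⌊x' - a⌋ = ⌈x - a⌉ - 1 ∧ ⌈x' - a⌉ = ⌈x - a⌉ := by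
  have h : Tendsto (fun x' => x' - a) (𝓝[<] x) (𝓝[<] (x - a)) :=
    tendsto_nhdsWithin_iff.2 ⟨(Continuous.tendsto (by fun_prop) x).mono_left nhdsWithin_le_nhds,
      eventually_nhdsWithin_of_forall fun y hy => sub_lt_sub_right (Set.mem_Iio.1 hy) a⟩
  have h1 := tendsto_pure.1 ((tendsto_floor_left_pure_ceil_sub_one (x - a)).comp h)
  have h2 := tendsto_pure.1 ((tendsto_ceil_left_pure_ceil (x - a)).comp
    (h.mono_right (nhdsWithin_mono _ Set.Iio_subset_Iic_self)))
  exact h1.and h2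

lemma floor_add_one_le_ceil {a b : ℝ} (h : a < b) : ⌊a⌋ + 1 ≤ ⌈b⌉ := by
  have h1 := Int.floor_le a
  have h2 := Int.le_ceil b
  have : (⌊a⌋ : ℝ) < ⌈b⌉ := by linarith
  exact_mod_cast this

lemma floor_add_one_eq_ceil_iff {a : ℝ} : ⌊a⌋ + 1 = ⌈a⌉ ↔ ∀ k : ℤ, a ≠ k := by
  constructor
  · rintro h k rfl
    simp at h
  · intro h
    refine le_antisymm ?_ (Int.ceil_le_floor_add_one a)
    have h1 := lt_of_le_of_ne (Int.floor_le a) (h ⌊a⌋).symm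
    have h2 := h1.trans_le (Int.le_ceil a)
    exact_mod_cast h2

/-! ### Blowing up a countable periodic set -/

section Series

variable {E : Set ℝ}

lemma abs_ceil_sub_le {x e : ℝ} (he : e ∈ Set.Ico (0 : ℝ) 1) : |(⌈x - e⌉ : ℝ)| ≤ |x| + 2 := by
  have h1 := Int.le_ceil (x - e)
  have h2 := Int.ceil_lt_add_one (x - e)
  have h3 := le_abs_self x
  have h4 := neg_abs_le x
  rw [abs_le]
  constructor <;> linarith [he.1, he.2]

lemma abs_floor_add_one_sub_le {x e : ℝ} (he : e ∈ Set.Ico (0 : ℝ) 1) :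
    |(⌊x - e⌋ : ℝ) + 1| ≤ |x| + 2 := by
  have h1 := Int.floor_le (x - e)
  have h2 := Int.lt_floor_add_one (x - e)
  have h3 := le_abs_self x
  have h4 := neg_abs_le x
  rw [abs_le]
  constructor <;> linarith [he.1, he.2]

variable {ι : Type*} {w e : ι → ℝ}

lemma summable_mul_ceil (hw : ∀ i, 0 < w i) (hs : Summable w)
    (he : ∀ i, e i ∈ Set.Ico (0 : ℝ) 1) (x : ℝ) : Summable fun i => w i * ⌈x - e i⌉ := by
  refine Summable.of_norm_bounded (hs.mul_right (|x| + 2)) fun i => ?_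
  rw [Real.norm_eq_abs, abs_mul, abs_of_pos (hw i)]
  exact mul_le_mul_of_nonneg_left (abs_ceil_sub_le (he i)) (hw i).le

lemma summable_mul_floor (hw : ∀ i, 0 < w i) (hs : Summable w)
    (he : ∀ i, e i ∈ Set.Ico (0 : ℝ) 1) (x : ℝ) : Summable fun i => w i * (⌊x - e i⌋ + 1) := by
  refine Summable.of_norm_bounded (hs.mul_right (|x| + 2)) fun i => ?_
  rw [Real.norm_eq_abs, abs_mul, abs_of_pos (hw i)]
  exact mul_le_mul_of_nonneg_left (abs_floor_add_one_sub_le (he i)) (hw i).le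

/-- Used with `F` a left or right neighbourhood filter: it shows that `L` below is left continuous
and has right limit `R`. -/
lemma tendsto_tsum_mul_ceil (hw : ∀ i, 0 < w i) (hs : Summable w)
    (he : ∀ i, e i ∈ Set.Ico (0 : ℝ) 1) {F : Filter ℝ} {x : ℝ} (hF : F ≤ 𝓝 x) {u : ι → ℝ}
    (hlim : ∀ i, ∀ᶠ x' in F, (⌈x' - e i⌉ : ℝ) = u i) :
    Tendsto (fun x' => ∑' i, w i * ⌈x' - e i⌉) F (𝓝 (∑' i, w i * u i)) := by
  refine tendsto_tsum_of_dominated_convergence (hs.mul_right (|x| + 1 + 2)) (fun i => ?_) ?_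
  · refine tendsto_const_nhds.congr' ?_
    filter_upwards [hlim i] with x' hx'
    rw [hx']
  · have h1 : ∀ᶠ x' in F, |x'| < |x| + 1 :=
      hF ((continuous_abs.tendsto x).eventually (gt_mem_nhds (by linarith)))
    filter_upwards [h1] with x' hx' i
    rw [Real.norm_eq_abs, abs_mul, abs_of_pos (hw i)]
    refine mul_le_mul_of_nonneg_left ((abs_ceil_sub_le (he i)).trans (by linarith)) (hw i).le

/-- A countable set invariant under integer translations is the set of points blown up by some
blow-up of the line. -/
theorem exists_blowup (hE : E.Countable) (hper : ∀ (x : ℝ) (k : ℤ), x ∈ E → x + k ∈ E) :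
    ∃ B : Blowup, ∀ x, B.L x = B.R x ↔ x ∉ E := by
  let ι := ↥(E ∩ Set.Ico 0 1)
  have : Countable ι := (hE.mono Set.inter_subset_left).to_subtype
  let _ : Encodable ι := Encodable.ofCountable ι
  obtain ⟨w, hw, W, hW, -⟩ := posSumOfEncodable (zero_lt_one' ℝ) ι
  let e : ι → ℝ := Subtype.val
  have he : ∀ i, e i ∈ Set.Ico (0 : ℝ) 1 := fun i => i.2.2
  have hs := hW.summable
  have hW0 : 0 ≤ W := hW.nonneg fun i => (hw i).le
  have h1W : 0 < 1 + W := by linarith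
  -- The sum is the (signed) weight of the points of `E` from `0` up to `x`, excluding `x` here and
  -- including it in `R`; hence a jump exactly at points of `E`. The summand `x` gives strict
  -- monotonicity, and dividing by `1 + W` restores period `1`.
  let L : ℝ → ℝ := fun x => (x + ∑' i, w i * ⌈x - e i⌉) / (1 + W)
  let R : ℝ → ℝ := fun x => (x + ∑' i, w i * (⌊x - e i⌋ + 1)) / (1 + W)
  have hle : ∀ x, L x ≤ R x := fun x => by
    refine div_le_div_of_nonneg_right (add_le_add le_rfl ?_) h1W.le
    refine (summable_mul_ceil hw hs he x).tsum_le_tsum (fun i => ?_) (summable_mul_floor hw hs he x)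
    refine mul_le_mul_of_nonneg_left ?_ (hw i).le
    exact_mod_cast Int.ceil_le_floor_add_one _
  have hlt : ∀ x x', x < x' → R x < L x' := fun x x' h => by
    refine div_lt_div_of_pos_right (add_lt_add_of_lt_of_le h ?_) h1W
    refine (summable_mul_floor hw hs he x).tsum_le_tsum (fun i => ?_) (summable_mul_ceil hw hs he x')
    refine mul_le_mul_of_nonneg_left ?_ (hw i).le
    exact_mod_cast floor_add_one_le_ceil (sub_lt_sub_right h _)
  have hL1 : ∀ x, L (x + 1) = L x + 1 := fun x => by
    have h2 : ∑' i, w i * (⌈x + 1 - e i⌉ : ℝ) = ∑' i, w i * (⌈x - e i⌉ : ℝ) + W := by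
      rw [← hW.tsum_eq, ← (summable_mul_ceil hw hs he x).tsum_add hs]
      refine tsum_congr fun i => ?_
      rw [add_sub_right_comm, Int.ceil_add_one]; push_cast; ring
    simp only [L, h2]
    field_simp
    ring
  have hR1 : ∀ x, R (x + 1) = R x + 1 := fun x => by
    have h2 : ∑' i, w i * ((⌊x + 1 - e i⌋ : ℝ) + 1) = ∑' i, w i * ((⌊x - e i⌋ : ℝ) + 1) + W := by
      rw [← hW.tsum_eq, ← (summable_mul_floor hw hs he x).tsum_add hs]
      refine tsum_congr fun i => ?_
      rw [add_sub_right_comm, Int.floor_add_one]; push_cast; ring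
    simp only [R, h2]
    field_simp
    ring
  have hmono : StrictMono L := fun x x' h => (hle x).trans_lt (hlt x x' h)
  -- The point is the supremum of `{x | L x ≤ y}`: the left limit of `L` there is at most `y`, the
  -- right limit at least `y`.
  have hcover : ∀ y, ∃ x, L x ≤ y ∧ y ≤ R x := fun y => by
    let A := {x | L x ≤ y}
    have hint : ∀ k : ℤ, L k = L 0 + k := fun k => by
      simpa using map_add_int_of_map_add_one hL1 0 k
    have hne : A.Nonempty := ⟨((⌊y - L 0⌋ : ℤ) : ℝ), by
      change L _ ≤ y
      rw [hint]; linarith [Int.floor_le (y - L 0)]⟩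
    have hbdd : BddAbove A := ⟨((⌈y - L 0⌉ : ℤ) : ℝ), fun x hx => by
      by_contra hc
      have h1 := hmono (not_le.1 hc)
      rw [hint] at h1
      have h2 : L x ≤ y := hx
      linarith [Int.le_ceil (y - L 0)]⟩
    refine ⟨sSup A, ?_, ?_⟩
    · have ht : Tendsto L (𝓝[<] sSup A) (𝓝 (L (sSup A))) := by
        refine Tendsto.div_const (Tendsto.add (tendsto_id.mono_left nhdsWithin_le_nhds) ?_) _
        refine tendsto_tsum_mul_ceil hw hs he nhdsWithin_le_nhds fun i => ?_
        filter_upwards [eventually_left_floor_ceil (sSup A) (e i)] with x' hx'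
        rw [hx'.2]
      refine le_of_tendsto ht ?_
      filter_upwards [self_mem_nhdsWithin] with x hx
      obtain ⟨x', hx', hlt'⟩ := exists_lt_of_lt_csSup hne (Set.mem_Iio.1 hx)
      exact (hmono hlt').le.trans hx'
    · have ht : Tendsto L (𝓝[>] sSup A) (𝓝 (R (sSup A))) := by
        refine Tendsto.div_const (Tendsto.add (tendsto_id.mono_left nhdsWithin_le_nhds) ?_) _
        refine tendsto_tsum_mul_ceil hw hs he nhdsWithin_le_nhds fun i => ?_
        filter_upwards [eventually_right_floor_ceil (sSup A) (e i)] with x' hx'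
        rw [hx'.2]; push_cast; rfl
      refine ge_of_tendsto ht ?_
      filter_upwards [self_mem_nhdsWithin] with x hx
      by_contra hc
      exact (not_le.2 (Set.mem_Ioi.1 hx)) (le_csSup hbdd (not_le.1 hc).le)
  refine ⟨⟨L, R, hle, hlt, hL1, hR1, hcover⟩, fun x => ?_⟩
  change L x = R x ↔ _
  have hJ : L x = R x ↔ ∀ i, ⌊x - e i⌋ + 1 = ⌈x - e i⌉ := by
    simp only [L, R, div_left_inj' h1W.ne', add_right_inj]
    constructor
    · intro h i
      by_contra hc
      refine h.not_lt ((summable_mul_ceil hw hs he x).tsum_lt_tsum (i := i) (fun j => ?_) ?_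
        (summable_mul_floor hw hs he x))
      · have h5 : (⌈x - e j⌉ : ℝ) ≤ ⌊x - e j⌋ + 1 := by
          exact_mod_cast Int.ceil_le_floor_add_one (x - e j)
        exact mul_le_mul_of_nonneg_left h5 (hw j).le
      · refine mul_lt_mul_of_pos_left ?_ (hw i)
        exact_mod_cast lt_of_le_of_ne (Int.ceil_le_floor_add_one (x - e i)) (Ne.symm hc)
    · intro h
      refine tsum_congr fun i => ?_
      rw [← h i]; push_cast; rfl
  rw [hJ]
  simp only [floor_add_one_eq_ceil_iff]
  constructor
  · intro h hx
    have h2 : Int.fract x ∈ E := by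
      have := hper x (-⌊x⌋) hx
      rwa [Int.cast_neg, ← sub_eq_add_neg] at this
    refine h ⟨Int.fract x, h2, Int.fract_nonneg x, Int.fract_lt_one x⟩ ⌊x⌋ ?_
    simp [e]
  · rintro h i k hk
    apply h
    have := hper (e i) k i.2.1
    rwa [← hk, add_sub_cancel] at this

end Series

/-! ### Images of minimal sets -/

section Transfer

variable {X Z : Type*} [TopologicalSpace X] [TopologicalSpace Z] {g : X ≃ₜ X} {f : Z ≃ₜ Z}
  {Y : Set X} {Ψ : X → Z}

lemma zpow_apply_mem_of_image_eq (hY : g '' Y = Y) {x : X} (hx : x ∈ Y) (i : ℤ) :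
    (g ^ i) x ∈ Y := by
  induction i with
  | zero => simpa using hx
  | succ i ih =>
    rw [add_comm, zpow_add, zpow_one, ← hY]
    exact ⟨_, ih, rfl⟩
  | pred i ih =>
    rw [sub_eq_neg_add, zpow_add, zpow_neg_one]
    rw [← hY] at ih
    obtain ⟨w, hw, h⟩ := ih
    have : (g⁻¹ * g ^ (-(i : ℤ))) x = w := by
      change g.symm ((g ^ (-(i : ℤ))) x) = w
      rw [← h]; simp
    rwa [this]

lemma zpow_apply_semiconj (hY : g '' Y = Y) (hΨ : ∀ x ∈ Y, f (Ψ x) = Ψ (g x)) {x : X}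
    (hx : x ∈ Y) (i : ℤ) : (f ^ i) (Ψ x) = Ψ ((g ^ i) x) := by
  induction i with
  | zero => simp
  | succ i ih =>
    rw [add_comm, zpow_add, zpow_one, zpow_add, zpow_one]
    change f ((f ^ (i : ℤ)) (Ψ x)) = Ψ (g ((g ^ (i : ℤ)) x))
    rw [ih, hΨ _ (zpow_apply_mem_of_image_eq hY hx i)]
  | pred i ih =>
    rw [sub_eq_neg_add, zpow_add, zpow_neg_one, zpow_add, zpow_neg_one]
    change f.symm ((f ^ (-(i : ℤ))) (Ψ x)) = Ψ (g.symm ((g ^ (-(i : ℤ))) x))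
    rw [ih, Homeomorph.symm_apply_eq, hΨ]
    · simp
    · have := zpow_apply_mem_of_image_eq hY hx (-1 + -(i : ℤ))
      rw [zpow_add, zpow_neg_one] at this
      exact this

lemma IsMinimalSet.image (hY : IsMinimalSet g Y) (hc : ContinuousOn Ψ Y)
    (hΨ : ∀ x ∈ Y, f (Ψ x) = Ψ (g x)) : IsMinimalSet f (Ψ '' Y) := by
  obtain ⟨hne, hcomp, hinv, hdense⟩ := hY
  refine ⟨hne.image _, hcomp.image_of_continuousOn hc, ?_, ?_⟩
  · conv_rhs => rw [← hinv]
    rw [Set.image_image, Set.image_image]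
    exact Set.image_congr hΨ
  · rintro _ ⟨x, hx, rfl⟩ _ ⟨y, hy, rfl⟩
    have h1 := hdense x hx hy
    have hsub : Set.range (fun n : ℤ => (g ^ n) x) ⊆ Y := by
      rintro _ ⟨n, rfl⟩
      exact zpow_apply_mem_of_image_eq hinv hx n
    have h2 := ((hc y hy).mono hsub).mem_closure_image h1
    refine closure_mono ?_ h2
    rintro _ ⟨_, ⟨n, rfl⟩, rfl⟩
    exact ⟨n, zpow_apply_semiconj hinv hΨ hx n⟩

end Transfer

/-! ### Codings of rotations by two-valued step functions -/

/-- `p` and `m` are the right and left continuous versions of a two-valued `1`-periodic step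
function without further periods. -/
structure StepPair (p m : ℝ → Fin 2) : Prop where
  measurable_right : Measurable p
  measurable_left : Measurable m
  periodic_right : Function.Periodic p 1
  periodic_left : Function.Periodic m 1
  right : ∀ x, ∀ᶠ x' in 𝓝[>] x, p x' = p x ∧ m x' = p x
  left : ∀ x, ∀ᶠ x' in 𝓝[<] x, p x' = m x ∧ m x' = m x
  countable : {x | p x ≠ m x}.Countable
  exists_ne : ∃ x, p x ≠ m x
  aperiodic : ∀ c, (∀ x, p (x + c) = p x) → ∃ k : ℤ, c = k

/-- The itinerary of `x` under the rotation by `α` with respect to `p`. -/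
def code (α : ℝ) (p : ℝ → Fin 2) (x : ℝ) : TwoShift := fun i => p (x + i * α)

section Code

variable {α : ℝ} {p m q n : ℝ → Fin 2}

lemma code_add (x : ℝ) : code α p (x + α) = shift (code α p x) := by
  ext i
  simp only [code, shift]
  push_cast
  rw [show x + α + i * α = x + (i + 1) * α by ring]

lemma periodic_code (hp : Function.Periodic p 1) : Function.Periodic (code α p) 1 := fun x => by
  ext i
  simp only [code]
  rw [add_right_comm, hp]

lemma measurable_code (hp : Measurable p) : Measurable (code α p) :=
  measurable_pi_lambda _ fun _ => hp.comp (measurable_id.add_const _)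

lemma shift_injective : Function.Injective shift := fun s t h => by
  ext i
  have := congrFun h (i - 1)
  simp only [shift, sub_add_cancel] at this
  rw [this]

lemma map_add_int_of_periodic {β : Type*} {u : ℝ → β} (hu : Function.Periodic u 1) (x : ℝ)
    (k : ℤ) : u (x + k) = u x := by
  simpa using hu.int_mul k x

lemma eventually_right_add {P : ℝ → Prop} {x c : ℝ} (h : ∀ᶠ x' in 𝓝[>] (x + c), P x') :
    ∀ᶠ x' in 𝓝[>] x, P (x' + c) := by
  have ht : Tendsto (fun x' => x' + c) (𝓝[>] x) (𝓝[>] (x + c)) :=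
    tendsto_nhdsWithin_iff.2 ⟨(Continuous.tendsto (by fun_prop) x).mono_left nhdsWithin_le_nhds,
      eventually_nhdsWithin_of_forall fun y hy => add_lt_add_left (Set.mem_Ioi.1 hy) c⟩
  exact ht.eventually h

lemma eventually_left_add {P : ℝ → Prop} {x c : ℝ} (h : ∀ᶠ x' in 𝓝[<] (x + c), P x') :
    ∀ᶠ x' in 𝓝[<] x, P (x' + c) := by
  have ht : Tendsto (fun x' => x' + c) (𝓝[<] x) (𝓝[<] (x + c)) :=
    tendsto_nhdsWithin_iff.2 ⟨(Continuous.tendsto (by fun_prop) x).mono_left nhdsWithin_le_nhds,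
      eventually_nhdsWithin_of_forall fun y hy => add_lt_add_left (Set.mem_Iio.1 hy) c⟩
  exact ht.eventually h

/-- Step functions with a common itinerary are translates of each other. -/
theorem StepPair.eq_translate_of_code_eq (hα : Irrational α) (hp : StepPair p m)
    (hq : StepPair q n) {x x' : ℝ} {s : TwoShift} (h1 : s = code α p x ∨ s = code α m x)
    (h2 : s = code α q x' ∨ s = code α n x') (z : ℝ) : p (x + z) = q (x' + z) := by
  have e1 := eventually_right_add (x := z) (c := x) (by rw [add_comm]; exact hp.right (x + z))
  have e2 := eventually_right_add (x := z) (c := x') (by rw [add_comm]; exact hq.right (x' + z))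
  obtain ⟨u, hu, hsub⟩ := mem_nhdsGT_iff_exists_Ioo_subset.1 (e1.and e2)
  -- All four functions are constant just to the right of `z`, after shifting by `x` or `x'`. A time
  -- `i` at which the rotation lands there makes the symbol `s i` equal to both values.
  obtain ⟨i, k, hik⟩ := exists_zmul_add_int_mem_Ioo hα (Set.mem_Ioi.1 hu)
  obtain ⟨⟨a1, a2⟩, b1, b2⟩ := hsub hik
  rw [show (i : ℝ) * α + k + x = x + i * α + k by ring] at a1 a2
  rw [show (i : ℝ) * α + k + x' = x' + i * α + k by ring] at b1 b2
  rw [map_add_int_of_periodic hp.periodic_right] at a1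
  rw [map_add_int_of_periodic hp.periodic_left] at a2
  rw [map_add_int_of_periodic hq.periodic_right] at b1
  rw [map_add_int_of_periodic hq.periodic_left] at b2
  have c1 : s i = p (x + z) := by
    rcases h1 with h | h <;> rw [h]
    exacts [a1, a2]
  have c2 : s i = q (x' + z) := by
    rcases h2 with h | h <;> rw [h]
    exacts [b1, b2]
  rw [← c1, c2]

/-- The points whose two itineraries differ. -/
def splitSet (α : ℝ) (p m : ℝ → Fin 2) : Set ℝ := {x | code α p x ≠ code α m x}

lemma StepPair.countable_splitSet (hp : StepPair p m) : (splitSet α p m).Countable := by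
  have : splitSet α p m = ⋃ i : ℤ, (fun x => x + i * α) ⁻¹' {x | p x ≠ m x} := by
    ext x
    simp [splitSet, code, funext_iff]
  rw [this]
  exact Set.countable_iUnion fun i => hp.countable.preimage (add_left_injective _)

lemma StepPair.splitSet_add_int (hp : StepPair p m) (x : ℝ) (k : ℤ) (hx : x ∈ splitSet α p m) :
    x + k ∈ splitSet α p m := by
  change code α p (x + k) ≠ code α m (x + k)
  rwa [map_add_int_of_periodic (periodic_code hp.periodic_right),
    map_add_int_of_periodic (periodic_code hp.periodic_left)]

lemma invariant_of_splitSet {B : Blowup} (hB : ∀ x, B.L x = B.R x ↔ x ∉ splitSet α p m) :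
    B.Invariant α := fun x => by
  rw [hB, hB]
  simp only [splitSet, Set.mem_ofPred_eq, not_not, code_add]
  exact shift_injective.eq_iff.symm

open Classical in
/-- The coding of the endpoints of the blow-up. -/
def endpointCode (B : Blowup) (α : ℝ) (p m : ℝ → Fin 2) (y : ℝ) : TwoShift :=
  if y = B.R (B.h y) then code α p (B.h y) else code α m (B.h y)

section EndpointCode

variable {B : Blowup}

lemma endpointCode_R (x : ℝ) : endpointCode B α p m (B.R x) = code α p x := by
  simp [endpointCode]

lemma endpointCode_L (hB : ∀ x, B.L x = B.R x ↔ x ∉ splitSet α p m) (x : ℝ) :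
    endpointCode B α p m (B.L x) = code α m x := by
  simp only [endpointCode, Blowup.h_L]
  split_ifs with h
  · simpa [splitSet] using (hB x).1 h
  · rfl

lemma endpointCode_or (y : ℝ) : endpointCode B α p m y = code α p (B.h y) ∨
    endpointCode B α p m y = code α m (B.h y) := by
  unfold endpointCode
  split_ifs <;> simp

lemma StepPair.periodic_endpointCode (hp : StepPair p m) :
    Function.Periodic (endpointCode B α p m) 1 := fun y => by
  simp only [endpointCode, Blowup.h_add_one, B.R_add_one, add_left_inj,
    periodic_code hp.periodic_right (B.h y), periodic_code hp.periodic_left (B.h y)]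

/-- Continuity of the coding, symbol by symbol. At a split point the gap isolates each end from the
other side, so one one-sided limit decides; at any other point the two codes coincide and both
limits agree. -/
lemma StepPair.eventually_endpointCode_eq (hp : StepPair p m)
    (hB : ∀ x, B.L x = B.R x ↔ x ∉ splitSet α p m) {y : ℝ} (hy : y ∈ B.endpoints) (i : ℤ) :
    ∀ᶠ y' in 𝓝 y, y' ∈ B.endpoints →
      endpointCode B α p m y' i = endpointCode B α p m y i := by
  have hr := ((Blowup.continuous_h (B := B)).tendsto y).eventually
    (eventually_nhdsWithin_iff.1 (eventually_right_add (hp.right (B.h y + i * α))))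
  have hl := ((Blowup.continuous_h (B := B)).tendsto y).eventually
    (eventually_nhdsWithin_iff.1 (eventually_left_add (hp.left (B.h y + i * α))))
  have hR : ∀ y', B.h y < B.h y' → p (B.h y' + i * α) = p (B.h y + i * α) ∧
      m (B.h y' + i * α) = p (B.h y + i * α) →
      endpointCode B α p m y' i = code α p (B.h y) i := by
    rintro y' - ⟨h1, h2⟩
    rcases endpointCode_or (B := B) (α := α) (p := p) (m := m) y' with h | h <;> rw [h]
    exacts [h1, h2]
  have hL : ∀ y', B.h y' < B.h y → p (B.h y' + i * α) = m (B.h y + i * α) ∧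
      m (B.h y' + i * α) = m (B.h y + i * α) →
      endpointCode B α p m y' i = code α m (B.h y) i := by
    rintro y' - ⟨h1, h2⟩
    rcases endpointCode_or (B := B) (α := α) (p := p) (m := m) y' with h | h <;> rw [h]
    exacts [h1, h2]
  rcases eq_or_ne (B.L (B.h y)) (B.R (B.h y)) with hLR | hLR
  · have hpm : code α p (B.h y) = code α m (B.h y) := by
      simpa [splitSet] using (hB _).1 hLR
    have hval : ∀ y', B.h y' = B.h y → endpointCode B α p m y' = code α p (B.h y) := by
      intro y' h'
      rcases endpointCode_or (B := B) (α := α) (p := p) (m := m) y' with h | h <;> rw [h, h']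
      exact hpm.symm
    filter_upwards [hr, hl] with y' h1 h2 _
    rw [hval y rfl]
    rcases lt_trichotomy (B.h y') (B.h y) with h | h | h
    · rw [hL y' h (h2 h), hpm]
    · rw [hval y' h]
    · exact hR y' h (h1 h)
  · have hlt := lt_of_le_of_ne (B.le (B.h y)) hLR
    rcases hy with hy | hy
    · have hval : endpointCode B α p m y = code α m (B.h y) := by
        conv_lhs => rw [hy]
        exact endpointCode_L hB _
      filter_upwards [hl, gt_mem_nhds (hy.trans_lt hlt)] with y' h2 h3 h4
      rw [hval]
      rcases lt_trichotomy (B.h y') (B.h y) with h | h | h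
      · exact hL y' h (h2 h)
      · rcases h4 with h4 | h4
        · rw [h4, h, endpointCode_L hB]
        · rw [h] at h4; linarith
      · linarith [B.lt _ _ h, B.L_h_le y']
    · have hval : endpointCode B α p m y = code α p (B.h y) := by
        conv_lhs => rw [hy]
        exact endpointCode_R _
      filter_upwards [hr, lt_mem_nhds (hlt.trans_eq hy.symm)] with y' h2 h3 h4
      rw [hval]
      rcases lt_trichotomy (B.h y') (B.h y) with h | h | h
      · linarith [B.lt _ _ h, B.le_R_h y']
      · rcases h4 with h4 | h4
        · rw [h] at h4; linarith
        · rw [h4, h, endpointCode_R]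
      · exact hR y' h (h2 h)

/-- Equal codes make `p` invariant under translation by `h y - h y'`, an integer by aperiodicity.
What remains is to tell the two ends of one gap apart, and these have different codes by the choice
of gaps. -/
lemma StepPair.endpointCode_injective (hα : Irrational α) (hp : StepPair p m)
    (hB : ∀ x, B.L x = B.R x ↔ x ∉ splitSet α p m) {y y' : ℝ} (hy : y ∈ B.endpoints)
    (hy' : y' ∈ B.endpoints) (h : endpointCode B α p m y = endpointCode B α p m y') :
    (y : UnitAddCircle) = y' := by
  have h1 := hp.eq_translate_of_code_eq hα hp
    (endpointCode_or (B := B) (α := α) (p := p) (m := m) y)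
    (by rw [h]; exact endpointCode_or y')
  obtain ⟨k, hk⟩ := hp.aperiodic (B.h y - B.h y') fun x => by
    have := h1 (x - B.h y')
    rw [show B.h y + (x - B.h y') = x + (B.h y - B.h y') by ring, add_sub_cancel] at this
    exact this
  refine coe_circle_eq_iff.2 ⟨k, ?_⟩
  have hh : B.h (y' + k) = B.h y := by
    rw [map_add_int_of_map_add_one B.h_add_one]; linarith
  have hc : endpointCode B α p m (y' + k) = endpointCode B α p m y := by
    rw [h, map_add_int_of_periodic hp.periodic_endpointCode]
  have hm := (Blowup.endpoints_add_int k).2 hy'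
  by_contra hne
  have key : ∀ x, B.L x ≠ B.R x → code α p x ≠ code α m x := fun x hx => by
    by_contra hc
    exact hx ((hB x).2 (by simpa [splitSet] using hc))
  rcases hy with e | e <;> rcases hm with e' | e' <;> rw [hh] at e'
  · exact hne (e.trans e'.symm)
  · have hd : B.L (B.h y) ≠ B.R (B.h y) := fun hd => hne (by rw [e, e', hd])
    refine key _ hd ?_
    rw [← endpointCode_R (B := B) (m := m), ← e', hc, e]
    simp only [Blowup.h_L]
    exact endpointCode_L hB _
  · have hd : B.L (B.h y) ≠ B.R (B.h y) := fun hd => hne (by rw [e, e', hd])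
    refine key _ hd ?_
    rw [← endpointCode_L hB, ← e', hc, e]
    simp only [Blowup.h_R]
    exact (endpointCode_R _).symm
  · exact hne (e.trans e'.symm)

lemma endpointCode_G (hB : ∀ x, B.L x = B.R x ↔ x ∉ splitSet α p m) {y : ℝ}
    (hy : y ∈ B.endpoints) :
    endpointCode B α p m (B.G α y) = shift (endpointCode B α p m y) := by
  rcases hy with h | h <;> rw [h]
  · rw [Blowup.G_L, endpointCode_L hB, endpointCode_L hB, code_add]
  · rw [Blowup.G_R (invariant_of_splitSet hB), endpointCode_R, endpointCode_R, code_add]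

end EndpointCode

end Code

/-! ### The strictly ergodic set defined by a step function -/

lemma volume_circle_countable {A : Set ℝ} (hA : A.Countable) :
    (volume : Measure UnitAddCircle) ((↑) '' A) = 0 := by
  have h : MeasurePreserving ((↑) : ℝ → UnitAddCircle) _ volume :=
    UnitAddCircle.measurePreserving_mk 0
  rw [← h.measure_preimage (hA.image _).measurableSet.nullMeasurableSet]
  refine (Set.Countable.mono (s₂ := ⋃ k : ℤ, (fun x => x + (k : ℝ)) '' A) ?_
    (Set.countable_iUnion fun k => hA.image _)).measure_zero _
  rintro x ⟨a, ha, hax⟩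
  obtain ⟨k, hk⟩ := coe_circle_eq_iff.1 hax.symm
  exact Set.mem_iUnion.2 ⟨k, a, ha, hk.symm⟩

/-- The itinerary map on the circle. -/
def circleCode (α : ℝ) (p : ℝ → Fin 2) (hp : Function.Periodic p 1) : UnitAddCircle → TwoShift :=
  circleLift (code α p) (periodic_code hp)

lemma measurable_circleCode {α : ℝ} {p : ℝ → Fin 2} (hp : Function.Periodic p 1)
    (hm : Measurable p) : Measurable (circleCode α p hp) :=
  measurable_circleLift _ (measurable_code hm)

lemma circleCode_add {α : ℝ} {p : ℝ → Fin 2} (hp : Function.Periodic p 1) (z : UnitAddCircle) :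
    circleCode α p hp (z + α) = shift (circleCode α p hp z) := by
  induction z using QuotientAddGroup.induction_on with
  | H x => exact code_add x

lemma StrictlyErgodicSet.isInvariantOn_measure {Z : Type*} [TopologicalSpace Z]
    [MeasurableSpace Z] {f : Z ≃ₜ Z} (D : StrictlyErgodicSet f) :
    IsInvariantOn f D.carrier D.measure := D.uniquelyErgodic.choose_spec.1

/-- Two strictly ergodic sets with the same measure meet. -/
lemma StrictlyErgodicSet.inter_nonempty_of_measure_eq {Z : Type*} [TopologicalSpace Z]
    [MeasurableSpace Z] {f : Z ≃ₜ Z} {D D' : StrictlyErgodicSet f}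
    (h : D.measure = D'.measure) : (D.carrier ∩ D'.carrier).Nonempty := by
  have h1 : ∀ᵐ z ∂(D.measure : Measure Z), z ∈ D.carrier := D.isInvariantOn_measure.2
  have h2 : ∀ᵐ z ∂(D.measure : Measure Z), z ∈ D'.carrier := by
    rw [h]; exact D'.isInvariantOn_measure.2
  obtain ⟨z, hz⟩ := (h1.and h2).exists
  exact ⟨z, hz⟩

section Horseshoe

variable {Z : Type*} [TopologicalSpace Z] [T2Space Z] [MeasurableSpace Z] [BorelSpace Z]
  {f : Z ≃ₜ Z} {γ : TwoShift → Z} {α : ℝ} {p m : ℝ → Fin 2}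

/-- For unique ergodicity: `π` semiconjugates `D` to the rotation, so every invariant measure on `D`
projects to Lebesgue measure; `σ` inverts `π` off the null set `E` of split points, so the measure
is the image of Lebesgue measure under `σ`. -/
theorem exists_strictlyErgodicSet (hγ : Continuous γ) (hinj : Function.Injective γ)
    (hf : ∀ s, f (γ s) = γ (shift s)) (hα : Irrational α) (hp : StepPair p m) :
    ∃ D : StrictlyErgodicSet f, IsDenjoyMinimalSet f D.carrier α ∧
      (D.measure : Measure Z) = volume.map (γ ∘ circleCode α p hp.periodic_right) ∧
      ∀ z ∈ D.carrier, ∃ x s, z = γ s ∧ (s = code α p x ∨ s = code α m x) := by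
  obtain ⟨B, hB⟩ := exists_blowup hp.countable_splitSet (hp.splitSet_add_int (α := α))
  have ha := invariant_of_splitSet hB
  set g := Blowup.circleHomeo ha with hg
  set Y := B.minimalSet with hYdef
  let κ : UnitAddCircle → TwoShift :=
    circleLift (endpointCode B α p m) hp.periodic_endpointCode
  have hκ : ContinuousOn κ Y := by
    rintro _ ⟨y, hy, rfl⟩
    refine tendsto_pi_nhds.2 fun i => ?_
    refine tendsto_const_nhds.congr' ?_
    rw [EventuallyEq, eventually_nhdsWithin_iff,
      ← QuotientAddGroup.isOpenQuotientMap_mk.map_nhds_eq, eventually_map]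
    filter_upwards [hp.eventually_endpointCode_eq hB hy i] with y' h1 h2
    exact (h1 (Blowup.coe_mem_minimalSet.1 h2)).symm
  have hκinj : Set.InjOn κ Y := by
    rintro _ ⟨y, hy, rfl⟩ _ ⟨y', hy', rfl⟩ h
    exact hp.endpointCode_injective hα hB hy hy' h
  have hκg : ∀ z ∈ Y, κ (g z) = shift (κ z) := by
    rintro _ ⟨y, hy, rfl⟩
    exact endpointCode_G hB hy
  let Ψ : UnitAddCircle → Z := γ ∘ κ
  have hΨ : ContinuousOn Ψ Y := hγ.comp_continuousOn hκ
  have hΨinj : Set.InjOn Ψ Y := hinj.comp_injOn hκinj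
  have hΨg : ∀ z ∈ Y, f (Ψ z) = Ψ (g z) := fun z hz => by
    change f (γ (κ z)) = γ (κ (g z))
    rw [hf, hκg z hz]
  have hmin : IsMinimalSet g Y := Blowup.isMinimalSet hα ha
  have hYc : CompactSpace Y := isCompact_iff_compactSpace.1 hmin.2.1
  let j : Y → Z := Y.domRestrict Ψ
  have hj : Topology.IsClosedEmbedding j :=
    (continuousOn_iff_continuous_domRestrict.1 hΨ).isClosedEmbedding (Set.injOn_iff_injective.1 hΨinj)
  have hjr : Set.range j = Ψ '' Y := Set.range_domRestrict Ψ Y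
  set D := Set.range j with hD
  have hDmin : IsMinimalSet f D := by rw [hjr]; exact hmin.image hΨ hΨg
  -- the inverse coding, from `D` to the circle of the rotation
  let hc : UnitAddCircle → UnitAddCircle :=
    circleLift _ (periodic_coe_of_map_add_one (Blowup.h_add_one (B := B)))
  have hcc : Continuous hc := continuous_circleLift _
    ((AddCircle.continuous_mk' 1).comp Blowup.continuous_h)
  -- The value `0` off `D` is immaterial, since the measures considered are carried by `D`.
  let π : Z → UnitAddCircle := Function.extend j (fun y : Y => hc y) (fun _ => 0)
  have hπ : Measurable π := hj.measurableEmbedding.measurable_extend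
    (hcc.comp continuous_subtype_val).measurable measurable_const
  have hπj : ∀ y : Y, π (j y) = hc y := fun y => hj.injective.extend_apply _ _ y
  have hπf : ∀ z ∈ D, π (f z) = π z + α := by
    rintro _ ⟨⟨_, y, hy, rfl⟩, rfl⟩
    have h1 : f (j ⟨(y : UnitAddCircle), y, hy, rfl⟩) =
        j ⟨(B.G α y : UnitAddCircle), _, Blowup.G_mem_endpoints ha hy, rfl⟩ :=
      hΨg _ ⟨y, hy, rfl⟩
    rw [h1, hπj, hπj]
    simp [hc]
  let σ : UnitAddCircle → Z := γ ∘ circleCode α p hp.periodic_right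
  have hσ : Measurable σ :=
    hγ.measurable.comp (measurable_circleCode _ hp.measurable_right)
  have hσD : ∀ z, σ z ∈ D := by
    intro z
    induction z using QuotientAddGroup.induction_on with
    | H x =>
      refine ⟨⟨(B.R x : UnitAddCircle), _, Blowup.R_mem_endpoints x, rfl⟩, ?_⟩
      exact congrArg γ (endpointCode_R x)
  have hσf : ∀ z, f (σ z) = σ (z + α) := fun z => by
    change f (γ _) = γ (circleCode α p hp.periodic_right (z + α))
    rw [circleCode_add, hf]
  let E : Set UnitAddCircle := (↑) '' splitSet α p m
  have hE : (volume : Measure UnitAddCircle) E = 0 :=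
    volume_circle_countable hp.countable_splitSet
  have hEm : MeasurableSet E := (hp.countable_splitSet.image _).measurableSet
  have hσπ : ∀ z ∈ D, π z ∉ E → σ (π z) = z := by
    rintro _ ⟨⟨_, y, hy, rfl⟩, rfl⟩ hz
    rw [hπj] at hz ⊢
    change ((B.h y : ℝ) : UnitAddCircle) ∉ E at hz
    have h1 : B.h y ∉ splitSet α p m := fun h => hz ⟨_, h, rfl⟩
    have h2 := (hB _).2 h1
    -- Off the split points the interval is a single point, so only the right code occurs.
    have h3 : y = B.R (B.h y) := by
      rcases hy with e | e
      · rw [← h2, ← e]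
      · exact e
    change γ (code α p (B.h y)) = γ (endpointCode B α p m y)
    conv_rhs => rw [h3, endpointCode_R]
  have hDm : MeasurableSet D := hj.isClosed_range.measurableSet
  have hvol : IsProbabilityMeasure (volume : Measure UnitAddCircle) :=
    ⟨UnitAddCircle.measure_univ⟩
  let μ₀ : ProbabilityMeasure Z :=
    ⟨volume.map σ, Measure.isProbabilityMeasure_map hσ.aemeasurable⟩
  have hμ₀ : IsInvariantOn f D μ₀ := by
    refine ⟨⟨f.continuous.measurable, ?_⟩, ?_⟩
    · change (volume.map σ).map f = volume.map σ
      rw [Measure.map_map f.continuous.measurable hσ]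
      have h1 : (f ∘ σ) = σ ∘ fun z => z + (α : UnitAddCircle) := funext hσf
      rw [h1, ← Measure.map_map hσ (measurable_add_const _), map_add_right_eq_self]
    · change volume.map σ Dᶜ = 0
      rw [Measure.map_apply hσ hDm.compl]
      have : σ ⁻¹' Dᶜ = ∅ := by
        ext z; simp [hσD z]
      rw [this, measure_empty]
  have huniq : ∀ μ : ProbabilityMeasure Z, IsInvariantOn f D μ → μ = μ₀ := by
    rintro μ ⟨hμf, hμD⟩
    have hae : ∀ᵐ z ∂(μ : Measure Z), z ∈ D := hμD
    have h1 : (μ : Measure Z).map π = volume := by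
      have : IsProbabilityMeasure ((μ : Measure Z).map π) :=
        Measure.isProbabilityMeasure_map hπ.aemeasurable
      refine eq_volume_of_map_add (addOrderOf_coe_of_irrational hα) _ ?_
      rw [Measure.map_map (measurable_add_const _) hπ]
      conv_rhs => rw [← hμf.map_eq, Measure.map_map hπ f.continuous.measurable]
      refine Measure.map_congr ?_
      filter_upwards [hae] with z hz
      exact (hπf z hz).symm
    have h2 : ∀ᵐ z ∂(μ : Measure Z), π z ∉ E := by
      have h3 : (μ : Measure Z) (π ⁻¹' E) = 0 := by
        rw [← Measure.map_apply hπ hEm, h1, hE]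
      exact measure_eq_zero_iff_ae_notMem.1 h3
    apply ProbabilityMeasure.toMeasure_injective
    change (μ : Measure Z) = volume.map σ
    rw [← h1, Measure.map_map hσ hπ]
    conv_lhs => rw [← Measure.map_id (μ := (μ : Measure Z))]
    refine Measure.map_congr ?_
    filter_upwards [hae, h2] with z hz hzE
    exact (hσπ z hz hzE).symm
  let DS : StrictlyErgodicSet f := ⟨D, hDmin, μ₀, hμ₀, huniq⟩
  refine ⟨DS, ⟨hDmin.2.1, hDmin.2.2.1, g, Y, ?_, hmin,
    hj.isEmbedding.toHomeomorph.symm, ?_⟩, ?_, ?_⟩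
  · obtain ⟨x, hx⟩ := hp.exists_ne
    refine Blowup.isDenjoyExample hα ha ⟨x, fun h => (hB x).1 h fun hc => hx ?_⟩
    simpa [code] using congrFun hc 0
  · rintro x y h
    obtain ⟨u, rfl⟩ := hj.isEmbedding.toHomeomorph.surjective x
    obtain ⟨v, rfl⟩ := hj.isEmbedding.toHomeomorph.surjective y
    rw [Homeomorph.symm_apply_apply, Homeomorph.symm_apply_apply]
    refine hΨinj v.2 (Blowup.circleHomeo_mem ha u.2) ?_
    rw [← hΨg _ u.2]
    exact h
  · have h1 : DS.measure = μ₀ := huniq _ DS.uniquelyErgodic.choose_spec.1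
    rw [h1]; rfl
  · rintro _ ⟨⟨_, y, hy, rfl⟩, rfl⟩
    exact ⟨B.h y, endpointCode B α p m y, rfl, endpointCode_or y⟩

end Horseshoe

/-! ### Frequencies -/

section Frequency

variable {α : ℝ} {p m : ℝ → Fin 2}

lemma shift_iterate (s : TwoShift) (i : ℕ) : shift^[i] s 0 = s i := by
  have : ∀ j : ℤ, shift^[i] s j = s (j + i) := by
    induction i with
    | zero => simp
    | succ i ih =>
      intro j
      rw [Function.iterate_succ_apply']
      simp only [shift, ih]
      push_cast
      ring_nf
  simpa using this 0

/-- The subset of the circle on which a step function takes the value `1`. -/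
def oneSet (p : ℝ → Fin 2) (hp : Function.Periodic p 1) : Set UnitAddCircle :=
  {z | circleLift p hp z = 1}

lemma measurableSet_oneSet (hp : Function.Periodic p 1) (hm : Measurable p) :
    MeasurableSet (oneSet p hp) :=
  measurable_circleLift hp hm (measurableSet_singleton 1)

/-- The frontier of `oneSet p hp` lies over the countably many points where `p` is not locally
constant, so it is null and equidistribution applies to every orbit. -/
lemma hasFrequencyOfOnes_code (hα : Irrational α) (hp : Function.Periodic p 1)
    (hm : Measurable p) (hc : {x | ¬ ∀ᶠ x' in 𝓝 x, p x' = p x}.Countable) (x : ℝ) :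
    HasFrequencyOfOnes (code α p x) ((volume : Measure UnitAddCircle).real (oneSet p hp)) := by
  have hfr : volume (frontier (oneSet p hp)) = 0 := by
    refine measure_mono_null ?_ (volume_circle_countable hc)
    intro z hz
    induction z using QuotientAddGroup.induction_on with
    | H x =>
      refine ⟨x, fun hx => ?_, rfl⟩
      have h1 : ∀ᶠ z in 𝓝 (x : UnitAddCircle), circleLift p hp z = p x := by
        rw [← QuotientAddGroup.isOpenQuotientMap_mk.map_nhds_eq, eventually_map]
        exact hx
      by_cases h : p x = 1
      · exact hz.2 (mem_interior_iff_mem_nhds.2 (by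
          filter_upwards [h1] with z h2
          exact h2.trans h))
      · obtain ⟨z, h2, h3⟩ := (mem_closure_iff_nhds.1 hz.1) _ h1
        exact h (h2.symm.trans h3)
  have h := tendsto_visit_frequency (addOrderOf_coe_of_irrational hα) (x : UnitAddCircle)
    (measurableSet_oneSet hp hm) hfr
  refine h.congr fun N => ?_
  congr 1
  refine Finset.sum_congr rfl fun i _ => ?_
  have h2 : (x : UnitAddCircle) + i • (α : UnitAddCircle) ∈ oneSet p hp ↔
      shift^[i] (code α p x) ∈ cylinderOne := by
    rw [cylinderOne, Set.mem_ofPred_eq, shift_iterate, ← AddCircle.coe_nsmul, ← AddCircle.coe_add,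
      nsmul_eq_mul]
    simp only [oneSet, code, Set.mem_ofPred_eq, circleLift_coe, Int.cast_natCast]
  by_cases h3 : shift^[i] (code α p x) ∈ cylinderOne
  · rw [Set.indicator_of_mem h3, Set.indicator_of_mem (h2.2 h3)]
  · rw [Set.indicator_of_notMem h3, Set.indicator_of_notMem (mt h2.1 h3)]

lemma eventually_nhds_of_left_right {P : ℝ → Prop} {x : ℝ} (hx : P x)
    (hl : ∀ᶠ x' in 𝓝[<] x, P x') (hr : ∀ᶠ x' in 𝓝[>] x, P x') : ∀ᶠ x' in 𝓝 x, P x' := by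
  rw [← nhdsNE_sup_pure, ← nhdsLT_sup_nhdsGT]
  exact eventually_sup.2 ⟨eventually_sup.2 ⟨hl, hr⟩, eventually_pure.2 hx⟩

theorem StepPair.hasFrequencyOfOnes (hα : Irrational α) (hp : StepPair p m) {s : TwoShift} {x : ℝ}
    (hs : s = code α p x ∨ s = code α m x) :
    HasFrequencyOfOnes s
      ((volume : Measure UnitAddCircle).real (oneSet p hp.periodic_right)) := by
  rcases hs with rfl | rfl
  · refine hasFrequencyOfOnes_code hα _ hp.measurable_right (hp.countable.mono ?_) x
    intro x hx h
    refine (Set.mem_ofPred_eq (p := fun x => ¬ ∀ᶠ x' in 𝓝 x, p x' = p x) ▸ hx) ?_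
    exact eventually_nhds_of_left_right rfl ((hp.left x).mono fun _ h1 => h1.1.trans h.symm)
      ((hp.right x).mono fun _ h1 => h1.1)
  -- The two versions differ on a countable set, so left codes have the same frequency.
  · have heq : (volume : Measure UnitAddCircle).real (oneSet p hp.periodic_right) =
        (volume : Measure UnitAddCircle).real (oneSet m hp.periodic_left) := by
      refine measureReal_congr ?_
      have h0 : ∀ᵐ z : UnitAddCircle, z ∉ ((↑) '' {x | p x ≠ m x} : Set UnitAddCircle) :=
        measure_eq_zero_iff_ae_notMem.1 (volume_circle_countable hp.countable)
      filter_upwards [h0] with z hz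
      induction z using QuotientAddGroup.induction_on with
      | H x =>
        have : p x = m x := by
          by_contra hc
          exact hz ⟨x, hc, rfl⟩
        apply propext
        change p x = 1 ↔ m x = 1
        rw [this]
    rw [heq]
    refine hasFrequencyOfOnes_code hα _ hp.measurable_left (hp.countable.mono ?_) x
    intro x hx h
    refine (Set.mem_ofPred_eq (p := fun x => ¬ ∀ᶠ x' in 𝓝 x, m x' = m x) ▸ hx) ?_
    exact eventually_nhds_of_left_right rfl ((hp.left x).mono fun _ h1 => h1.2)
      ((hp.right x).mono fun _ h1 => h1.2.trans h)

end Frequency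

/-! ### A family of step functions -/

section Family

variable {n : ℕ}

/-- The right continuous counting function of the translates of the intervals
`[j s, j s + l j)`. -/
def rightCount (s : ℝ) (l : Fin (n + 1) → ℝ) (x : ℝ) : ℤ :=
  ∑ j : Fin (n + 1), (⌊x - j * s⌋ - ⌊x - (j * s + l j)⌋)

/-- The left continuous counting function of the translates of the intervals
`(j s, j s + l j]`. -/
def leftCount (s : ℝ) (l : Fin (n + 1) → ℝ) (x : ℝ) : ℤ :=
  ∑ j : Fin (n + 1), (⌈x - j * s⌉ - ⌈x - (j * s + l j)⌉)

/-- Detects the integer `1`. -/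
def isOne (k : ℤ) : Fin 2 := if k = 1 then 1 else 0

lemma isOne_eq_one {k : ℤ} : isOne k = 1 ↔ k = 1 := by
  unfold isOne
  split_ifs with h <;> simp [h]

/-- The right continuous indicator function of the union of the intervals `[j s, j s + l j)`
modulo `1`. -/
def rightStep (s : ℝ) (l : Fin (n + 1) → ℝ) (x : ℝ) : Fin 2 := isOne (rightCount s l x)

/-- The left continuous version of `rightStep`. -/
def leftStep (s : ℝ) (l : Fin (n + 1) → ℝ) (x : ℝ) : Fin 2 := isOne (leftCount s l x)

/-- Lengths for which the intervals `[j s, j s + l j)` are disjoint in `[0, 1)`, with the last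
gap of length at least `r` and the other gaps shorter than `r`. -/
structure Admissible (s r : ℝ) (l : Fin (n + 1) → ℝ) : Prop where
  r_pos : 0 < r
  pos : ∀ j, 0 < l j
  lt : ∀ j, l j < s
  gap : ∀ j, s - l j < r
  last : ∀ j, n * s + l j ≤ 1 - r

variable {s r : ℝ} {l l' : Fin (n + 1) → ℝ}

lemma measurable_rightStep : Measurable (rightStep s l) := by
  refine (measurable_of_countable isOne).comp ?_
  unfold rightCount
  fun_prop

lemma measurable_leftStep : Measurable (leftStep s l) := by
  refine (measurable_of_countable isOne).comp ?_
  unfold leftCount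
  fun_prop

lemma periodic_rightStep : Function.Periodic (rightStep s l) 1 := fun x => by
  simp only [rightStep, rightCount, add_sub_right_comm, Int.floor_add_one, sub_add_eq_sub_sub _ _ (1 : ℤ),
    sub_add_cancel]

lemma periodic_leftStep : Function.Periodic (leftStep s l) 1 := fun x => by
  simp only [leftStep, leftCount, add_sub_right_comm, Int.ceil_add_one, sub_add_eq_sub_sub _ _ (1 : ℤ),
    sub_add_cancel]

lemma eventually_right_step (x : ℝ) :
    ∀ᶠ x' in 𝓝[>] x, rightStep s l x' = rightStep s l x ∧ leftStep s l x' = rightStep s l x := by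
  have h1 := eventually_all.2 fun j : Fin (n + 1) => eventually_right_floor_ceil x (j * s)
  have h2 := eventually_all.2 fun j : Fin (n + 1) => eventually_right_floor_ceil x (j * s + l j)
  filter_upwards [h1, h2] with x' e1 e2
  simp only [rightStep, leftStep, rightCount, leftCount, e1, e2, add_sub_add_right_eq_sub, and_self]

lemma eventually_left_step (x : ℝ) :
    ∀ᶠ x' in 𝓝[<] x, rightStep s l x' = leftStep s l x ∧ leftStep s l x' = leftStep s l x := by
  have h1 := eventually_all.2 fun j : Fin (n + 1) => eventually_left_floor_ceil x (j * s)
  have h2 := eventually_all.2 fun j : Fin (n + 1) => eventually_left_floor_ceil x (j * s + l j)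
  filter_upwards [h1, h2] with x' e1 e2
  simp only [rightStep, leftStep, rightCount, leftCount, e1, e2, sub_sub_sub_cancel_right, and_self]

lemma countable_sub_mem_int (a : ℝ) : {x : ℝ | ∃ k : ℤ, x - a = k}.Countable := by
  refine (Set.countable_range fun k : ℤ => a + (k : ℝ)).mono ?_
  rintro x ⟨k, hk⟩
  exact ⟨k, by simp only; linarith⟩

lemma countable_step_ne : {x | rightStep s l x ≠ leftStep s l x}.Countable := by
  refine ((Set.countable_iUnion fun j : Fin (n + 1) => countable_sub_mem_int (j * s)).union
    (Set.countable_iUnion fun j : Fin (n + 1) => countable_sub_mem_int (j * s + l j))).mono ?_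
  intro x hx
  by_contra hc
  simp only [Set.mem_union, Set.mem_iUnion, Set.mem_ofPred_eq, not_or, not_exists] at hc
  refine hx ?_
  have h1 := fun j => floor_add_one_eq_ceil_iff.2 (hc.1 j)
  have h2 := fun j => floor_add_one_eq_ceil_iff.2 (hc.2 j)
  simp only [rightStep, leftStep, rightCount, leftCount, ← h1, ← h2, add_sub_add_right_eq_sub]

/-! ### Shape of admissible step functions and recovery of the lengths -/

namespace Admissible

variable (hl : Admissible s r l)
include hl

lemma s_pos : 0 < s := (hl.pos 0).trans (hl.lt 0)

lemma r_lt_one : r < 1 := by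
  have h1 := hl.last 0
  have h2 := mul_nonneg (Nat.cast_nonneg (α := ℝ) n) hl.s_pos.le
  linarith [hl.pos 0]

lemma left_nonneg (j : Fin (n + 1)) : 0 ≤ (j : ℝ) * s :=
  mul_nonneg (Nat.cast_nonneg _) hl.s_pos.le

lemma right_le (j : Fin (n + 1)) : (j : ℝ) * s + l j ≤ 1 - r := by
  have h1 : (j : ℝ) ≤ n := by exact_mod_cast Nat.lt_succ_iff.1 j.2
  have := mul_le_mul_of_nonneg_right h1 hl.s_pos.le
  linarith [hl.last j]

lemma add_le_of_lt {i j : Fin (n + 1)} (h : i < j) : (i : ℝ) * s + s ≤ j * s := by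
  have h1 : (i : ℝ) + 1 ≤ j := by exact_mod_cast h
  have := mul_le_mul_of_nonneg_right h1 hl.s_pos.le
  linarith

lemma eq_of_mem {x : ℝ} {i j : Fin (n + 1)} (hi : (i : ℝ) * s ≤ x ∧ x < i * s + l i)
    (hj : (j : ℝ) * s ≤ x ∧ x < j * s + s) : i = j := by
  rcases lt_trichotomy i j with h | h | h
  · linarith [hl.add_le_of_lt h, hl.lt i]
  · exact h
  · linarith [hl.add_le_of_lt h]

lemma floor_sub_floor {x : ℝ} (hx : x ∈ Set.Ico (0 : ℝ) 1) (j : Fin (n + 1)) :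
    ⌊x - j * s⌋ - ⌊x - (j * s + l j)⌋ = if (j : ℝ) * s ≤ x ∧ x < j * s + l j then 1 else 0 := by
  have h1 := hl.left_nonneg j
  have h2 := hl.right_le j
  have h3 := hl.pos j
  have h4 := hl.r_pos
  have hx1 := hx.1
  have hx2 := hx.2
  have key : ∀ a : ℝ, 0 ≤ a → a < 1 → ⌊x - a⌋ = if a ≤ x then 0 else -1 := by
    intro a ha ha'
    split_ifs with h
    · rw [Int.floor_eq_iff]; constructor <;> push_cast <;> linarith
    · rw [Int.floor_eq_iff]; constructor <;> push_cast <;> linarith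
  rw [key _ h1 (by linarith), key _ (by linarith) (by linarith)]
  by_cases c1 : (j : ℝ) * s ≤ x <;> by_cases c2 : (j : ℝ) * s + l j ≤ x
  · simp [c1, c2, not_lt.2 c2]
  · simp [c1, c2, not_le.1 c2]
  · linarith
  · simp [c1, c2]

lemma rightStep_eq_one_iff {x : ℝ} (hx : x ∈ Set.Ico (0 : ℝ) 1) :
    rightStep s l x = 1 ↔ ∃ j : Fin (n + 1), (j : ℝ) * s ≤ x ∧ x < j * s + l j := by
  rw [rightStep, isOne_eq_one, rightCount, Finset.sum_congr rfl fun j _ => hl.floor_sub_floor hx j]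
  constructor
  · intro h
    by_contra hc
    push Not at hc
    rw [Finset.sum_eq_zero] at h
    · exact zero_ne_one h
    · intro j _
      rw [if_neg]
      exact fun h => absurd h.2 (not_lt.2 (hc j h.1))
  · rintro ⟨j, hj⟩
    rw [Finset.sum_eq_single j]
    · rw [if_pos hj]
    · intro i _ hi
      rw [if_neg]
      exact fun h => hi (hl.eq_of_mem h ⟨hj.1, hj.2.trans (by linarith [hl.lt j])⟩)
    · simp

lemma rightStep_zero : rightStep s l 0 = 1 :=
  (hl.rightStep_eq_one_iff (by simp)).2 ⟨0, by simp, by simpa using hl.pos 0⟩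

lemma leftStep_zero : leftStep s l 0 = 0 := by
  have h : leftCount s l 0 = 0 := by
    refine Finset.sum_eq_zero fun j _ => ?_
    have h1 := hl.left_nonneg j
    have h2 := hl.right_le j
    have h3 := hl.pos j
    have h4 := hl.r_pos
    have key : ∀ a : ℝ, 0 ≤ a → a < 1 → ⌈0 - a⌉ = 0 := by
      intro a ha ha'
      rw [Int.ceil_eq_iff]; constructor <;> push_cast <;> linarith
    rw [key _ h1 (by linarith), key _ (by linarith) (by linarith), sub_self]
  rw [leftStep, h]
  rfl

/-- The only points of the set preceded by a gap of length `r` are the integers. -/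
lemma eq_int_of_marker {z : ℝ} (hz : rightStep s l z = 1)
    (hgap : ∀ y, z - r ≤ y → y < z → rightStep s l y ≠ 1) : ∃ k : ℤ, z = k := by
  have hfr : ∀ y, rightStep s l (y + ⌊z⌋) = rightStep s l y := fun y =>
    map_add_int_of_periodic periodic_rightStep y _
  set z₀ := Int.fract z with hz₀
  have hzz : z = z₀ + ⌊z⌋ := (Int.fract_add_floor z).symm
  have hz1 : rightStep s l z₀ = 1 := by rw [← hfr, ← hzz, hz]
  have hgap1 : ∀ y, z₀ - r ≤ y → y < z₀ → rightStep s l y ≠ 1 := fun y h1 h2 => by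
    rw [← hfr]
    exact hgap _ (by linarith) (by linarith)
  have hlt := Int.fract_lt_one z
  have hmem : z₀ ∈ Set.Ico (0 : ℝ) 1 := ⟨Int.fract_nonneg z, hlt⟩
  obtain ⟨j, hj1, hj2⟩ := (hl.rightStep_eq_one_iff hmem).1 hz1
  have hr := hl.r_pos
  have hj0 := hl.left_nonneg j
  -- Inside a block, points just before `z₀` still belong to that block.
  have hz0 : z₀ = j * s := by
    by_contra hne
    have h1 : (j : ℝ) * s < z₀ := lt_of_le_of_ne hj1 (Ne.symm hne)
    have h2 : max ((j : ℝ) * s) (z₀ - r) < z₀ := max_lt h1 (by linarith)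
    have h3 := le_max_left ((j : ℝ) * s) (z₀ - r)
    exact hgap1 _ (le_max_right _ _) h2 ((hl.rightStep_eq_one_iff
      ⟨by linarith, by linarith⟩).2 ⟨j, h3, by linarith⟩)
  rcases Fin.eq_zero_or_eq_succ j with rfl | ⟨i, rfl⟩
  · refine ⟨⌊z⌋, ?_⟩
    rw [hzz, hz0]; simp
  · exfalso
    have hs := hl.s_pos
    -- The gap before a later block is shorter than `r`, so the window of length `r` reaches back
    -- into the previous block.
    have e : z₀ = (i.castSucc : Fin (n + 1)) * s + s := by
      rw [hz0]
      simp only [Fin.val_succ, Fin.val_castSucc]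
      push_cast; ring
    have h0 := hl.left_nonneg i.castSucc
    have h1 := hl.gap i.castSucc
    have h2 := hl.pos i.castSucc
    set a := ((i.castSucc : Fin (n + 1)) : ℝ) * s with ha
    have h3 := le_max_left a (z₀ - r)
    have h4 : max a (z₀ - r) < z₀ := max_lt (by linarith) (by linarith)
    have h5 : max a (z₀ - r) < a + l i.castSucc := max_lt (by linarith) (by linarith)
    exact hgap1 _ (le_max_right _ _) h4 ((hl.rightStep_eq_one_iff
      ⟨by linarith, by linarith⟩).2 ⟨i.castSucc, h3, h5⟩)

lemma rightStep_ne_one_of_neg {y : ℝ} (h1 : -r ≤ y) (h2 : y < 0) : rightStep s l y ≠ 1 := by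
  rw [← periodic_rightStep y]
  have hr := hl.r_lt_one
  intro h
  obtain ⟨j, -, hj⟩ := (hl.rightStep_eq_one_iff ⟨by linarith, by linarith⟩).1 h
  linarith [hl.right_le j]

/-- For `l'` the origin starts a block preceded by a gap of length `r`; translation carries this
marker to `c`, and the markers of `l` are integers. -/
lemma eq_int_of_translate (hl' : Admissible s r l') {c : ℝ}
    (h : ∀ x, rightStep s l (x + c) = rightStep s l' x) : ∃ k : ℤ, c = k := by
  refine hl.eq_int_of_marker ?_ fun y h1 h2 => ?_
  · rw [← zero_add c, h, hl'.rightStep_zero]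
  · rw [← sub_add_cancel y c, h]
    exact hl'.rightStep_ne_one_of_neg (by linarith) (by linarith)

/-- If `l j < l' j`, the point `j * s + l j` belongs to a block of `l'` but to none of `l`. -/
lemma length_le_of_eq (hl' : Admissible s r l') (h : rightStep s l = rightStep s l')
    (j : Fin (n + 1)) : l' j ≤ l j := by
  by_contra hc
  have hc := not_le.1 hc
  have h1 := hl.left_nonneg j
  have h2 := hl.right_le j
  have h3 := hl.pos j
  have h4 := hl.r_pos
  have hmem : (j : ℝ) * s + l j ∈ Set.Ico (0 : ℝ) 1 := ⟨by linarith, by linarith⟩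
  have h5 := (hl'.rightStep_eq_one_iff hmem).2 ⟨j, by linarith, by linarith⟩
  rw [← h, hl.rightStep_eq_one_iff hmem] at h5
  obtain ⟨i, hi⟩ := h5
  have := hl.eq_of_mem hi (j := j) ⟨by linarith, by linarith [hl.lt j]⟩
  subst this
  linarith [hi.2]

/-- The lengths are determined by the step function up to translation. -/
theorem eq_of_translate (hl' : Admissible s r l') {c : ℝ}
    (h : ∀ x, rightStep s l (x + c) = rightStep s l' x) : l = l' := by
  obtain ⟨k, rfl⟩ := hl.eq_int_of_translate hl' h
  have h1 : rightStep s l = rightStep s l' := by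
    ext x
    rw [← h, map_add_int_of_periodic periodic_rightStep]
  ext j
  exact le_antisymm (hl'.length_le_of_eq hl h1.symm j) (hl.length_le_of_eq hl' h1 j)

theorem stepPair : StepPair (rightStep s l) (leftStep s l) where
  measurable_right := measurable_rightStep
  measurable_left := measurable_leftStep
  periodic_right := periodic_rightStep
  periodic_left := periodic_leftStep
  right := eventually_right_step
  left := eventually_left_step
  countable := countable_step_ne
  exists_ne := ⟨0, by rw [hl.rightStep_zero, hl.leftStep_zero]; decide⟩
  aperiodic _ h := hl.eq_int_of_translate hl h

theorem volume_oneSet :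
    (volume : Measure UnitAddCircle).real (oneSet (rightStep s l) periodic_rightStep) =
      ∑ j, l j := by
  have hmp : MeasurePreserving ((↑) : ℝ → UnitAddCircle) _ volume :=
    UnitAddCircle.measurePreserving_mk 0
  have hset : ((↑) : ℝ → UnitAddCircle) ⁻¹' (oneSet (rightStep s l) periodic_rightStep) ∩
      Set.Ico 0 (0 + 1) = ⋃ j : Fin (n + 1), Set.Ico ((j : ℝ) * s) (j * s + l j) := by
    ext x
    simp only [Set.mem_inter_iff, Set.mem_preimage, oneSet, Set.mem_ofPred_eq, circleLift_coe,
      Set.mem_iUnion, zero_add]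
    constructor
    · rintro ⟨h1, h2⟩
      exact (hl.rightStep_eq_one_iff h2).1 h1
    · rintro ⟨j, hj⟩
      have hx : x ∈ Set.Ico (0 : ℝ) 1 :=
        ⟨(hl.left_nonneg j).trans hj.1, by linarith [hj.2, hl.right_le j, hl.r_pos]⟩
      exact ⟨(hl.rightStep_eq_one_iff hx).2 ⟨j, hj⟩, hx⟩
  have hm := measurableSet_oneSet (periodic_rightStep (s := s) (l := l)) measurable_rightStep
  have hv : (volume : Measure UnitAddCircle) (oneSet (rightStep s l) periodic_rightStep) =
      ∑ j, ENNReal.ofReal (l j) := by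
    rw [← hmp.measure_preimage hm.nullMeasurableSet,
      ← Measure.restrict_congr_set (Ico_ae_eq_Ioc (μ := volume) (a := (0 : ℝ)) (b := 0 + 1)),
      Measure.restrict_apply (hm.preimage hmp.measurable), hset, measure_iUnion]
    · rw [tsum_fintype]
      simp
    · intro i j hij
      refine Set.disjoint_left.2 fun x hi hj => hij ?_
      exact hl.eq_of_mem hi ⟨hj.1, hj.2.trans (by linarith [hl.lt j])⟩
    · exact fun j => measurableSet_Ico
  rw [Measure.real, hv, ENNReal.toReal_sum fun j _ => ENNReal.ofReal_ne_top]
  exact Finset.sum_congr rfl fun j _ => ENNReal.toReal_ofReal (hl.pos j).le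

end Admissible

/-! ### Continuity in the lengths -/

lemma eventually_floor_eq {u : ℝ} (hu : ∀ k : ℤ, u ≠ k) : ∀ᶠ u' in 𝓝 u, ⌊u'⌋ = ⌊u⌋ := by
  have h1 := lt_of_le_of_ne (Int.floor_le u) (hu _).symm
  filter_upwards [Ioo_mem_nhds h1 (Int.lt_floor_add_one u)] with u' h
  exact Int.floor_eq_iff.2 ⟨h.1.le, h.2⟩

lemma continuousAt_code {V : Type*} [TopologicalSpace V] {L : V → Fin (n + 1) → ℝ}
    (hL : Continuous L) {α x : ℝ} {v : V}
    (hx : ∀ (i : ℤ) (j : Fin (n + 1)) (k : ℤ), x + i * α - (j * s + L v j) ≠ k) :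
    ContinuousAt (fun v => code α (rightStep s (L v)) x) v := by
  refine continuousAt_pi.2 fun i => ?_
  refine tendsto_const_nhds.congr' ?_
  have h : ∀ j, ∀ᶠ w in 𝓝 v,
      ⌊x + i * α - (j * s + L w j)⌋ = ⌊x + i * α - (j * s + L v j)⌋ := fun j => by
    have hc : Continuous fun w => x + i * α - (j * s + L w j) := by fun_prop
    exact (hc.tendsto v).eventually (eventually_floor_eq (hx i j))
  filter_upwards [eventually_all.2 h] with w hw
  simp only [code, rightStep, rightCount, hw]

/-- Only the right ends of the blocks move with `v`. For fixed `v`, all but countably many `x` have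
orbits avoiding them modulo `1`, and there each symbol is locally constant in `v`; dominated
convergence does the rest. -/
theorem continuous_integral_code {V Z : Type*} [TopologicalSpace V] [FirstCountableTopology V]
    [TopologicalSpace Z] [MeasurableSpace Z] [BorelSpace Z] {γ : TwoShift → Z}
    (hγ : Continuous γ) {L : V → Fin (n + 1) → ℝ} (hL : Continuous L) (α : ℝ)
    (φ : BoundedContinuousFunction Z ℝ) :
    Continuous fun v => ∫ z : UnitAddCircle,
      φ (γ (circleCode α (rightStep s (L v)) periodic_rightStep z)) := by
  rw [continuous_iff_continuousAt]
  intro v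
  refine continuousAt_of_dominated (bound := fun _ => ‖φ‖) (Eventually.of_forall fun w => ?_)
    (Eventually.of_forall fun w => Eventually.of_forall fun z => φ.norm_coe_le_norm _)
    (integrable_const _) ?_
  · exact ((φ.continuous.measurable.comp hγ.measurable).comp
      (measurable_circleCode _ measurable_rightStep)).aestronglyMeasurable
  · have hA : {x : ℝ | ∃ (i : ℤ) (j : Fin (n + 1)) (k : ℤ),
        x + i * α - (j * s + L v j) = k}.Countable := by
      refine (Set.countable_iUnion fun i : ℤ => Set.countable_iUnion fun j : Fin (n + 1) =>
        countable_sub_mem_int (j * s + L v j - i * α)).mono ?_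
      rintro x ⟨i, j, k, h⟩
      exact Set.mem_iUnion.2 ⟨i, Set.mem_iUnion.2 ⟨j, k, by linarith⟩⟩
    filter_upwards [measure_eq_zero_iff_ae_notMem.1 (volume_circle_countable hA)] with z hz
    induction z using QuotientAddGroup.induction_on with
    | H x =>
      refine (φ.continuous.comp hγ).continuousAt.comp (f := fun w =>
        circleCode α (rightStep s (L w)) periodic_rightStep (x : UnitAddCircle))
        (continuousAt_code hL fun i j k h => hz ⟨x, ⟨i, j, k, h⟩, rfl⟩)

end Family

/-! ### Parametrization by a ball -/

section Ball

variable {n : ℕ}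

/-- A vector with vanishing coordinate sum and prescribed coordinates except the first. -/
def balanced (v : EuclideanSpace ℝ (Fin n)) : Fin (n + 1) → ℝ :=
  Fin.cons (-∑ i, v i) fun i => v i

lemma sum_balanced (v : EuclideanSpace ℝ (Fin n)) : ∑ j, balanced v j = 0 := by
  rw [balanced, Fin.sum_cons]; ring

lemma continuous_balanced : Continuous (balanced (n := n)) := by
  refine continuous_pi fun j => ?_
  refine Fin.cases ?_ (fun i => ?_) j
  · simp only [balanced, Fin.cons_zero]; fun_prop
  · simp only [balanced, Fin.cons_succ]; fun_prop

lemma balanced_injective : Function.Injective (balanced (n := n)) := fun v w h => by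
  ext i
  have := congrFun h i.succ
  simpa [balanced] using this

lemma abs_balanced_le {v : EuclideanSpace ℝ (Fin n)} (hv : ‖v‖ ≤ 1) (j : Fin (n + 1)) :
    |balanced v j| ≤ n + 1 := by
  have h1 : ∀ i, |v i| ≤ 1 := fun i => (PiLp.norm_apply_le v i).trans hv
  refine Fin.cases ?_ (fun i => ?_) j
  · simp only [balanced, Fin.cons_zero, abs_neg]
    refine (Finset.abs_sum_le_sum_abs _ _).trans ?_
    refine (Finset.sum_le_sum fun i _ => h1 i).trans ?_
    simp
  · simp only [balanced, Fin.cons_succ]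
    have := Nat.cast_nonneg (α := ℝ) n
    linarith [h1 i]

/-- Over the unit ball there is an injective continuous family of admissible lengths with
constant sum `t`. -/
theorem exists_admissible_family (n : ℕ) {t : ℝ} (ht0 : 0 < t) (ht1 : t < 1) :
    ∃ (s r : ℝ) (L : Metric.closedBall (0 : EuclideanSpace ℝ (Fin n)) 1 → Fin (n + 1) → ℝ),
      Continuous L ∧ Function.Injective L ∧ ∀ v, Admissible s r (L v) ∧ ∑ j, L v j = t := by
  have hN : (0 : ℝ) < n + 1 := by positivity
  obtain ⟨τ, hτ⟩ : ∃ τ : ℝ, τ = t / (n + 1) := ⟨_, rfl⟩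
  obtain ⟨d, hd⟩ : ∃ d : ℝ, d = (1 - t) / (n + 1) := ⟨_, rfl⟩
  have hτN : (n + 1) * τ = t := by rw [hτ]; field_simp
  have hdN : (n + 1) * d = 1 - t := by rw [hd]; field_simp
  have hτ0 : 0 < τ := by rw [hτ]; positivity
  have hd0 : 0 < d := by rw [hd]; exact div_pos (by linarith) hN
  have hn0 : (0 : ℝ) ≤ n := Nat.cast_nonneg n
  have hd1 : d ≤ 1 - t := by rw [← hdN]; nlinarith
  -- `τ` is the mean block length, `d` the mean gap and `δ` bounds the change in length. Inner gaps
  -- are about `d / 2`, within `δ`, hence below `r = d / 2 + 2 * δ`. The last gap needs `t + (1 - t)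
  -- / 2 + 3 * δ ≤ 1`, whence the factor `6`.
  obtain ⟨δ, hδ0, hδd, hδτ⟩ : ∃ δ : ℝ, 0 < δ ∧ 6 * δ ≤ d ∧ δ < τ :=
    ⟨min d τ / 6, by positivity, by linarith [min_le_left d τ], by linarith [min_le_right d τ]⟩
  refine ⟨τ + d / 2, d / 2 + 2 * δ, fun v j => τ + δ / (n + 1) * balanced v.1 j, ?_, ?_, ?_⟩
  · have := continuous_balanced (n := n)
    fun_prop
  · intro v w h
    apply Subtype.ext
    apply balanced_injective
    ext j
    have h1 := congrFun h j
    have h2 : δ / (n + 1) ≠ 0 := by positivity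
    exact mul_left_cancel₀ h2 (add_left_cancel h1)
  · intro v
    have hv : ‖v.1‖ ≤ 1 := mem_closedBall_zero_iff.1 v.2
    have hb : ∀ j, |δ / (n + 1) * balanced v.1 j| ≤ δ := fun j => by
      rw [abs_mul, abs_of_pos (by positivity)]
      calc δ / (n + 1) * |balanced v.1 j| ≤ δ / (n + 1) * (n + 1) := by
            gcongr
            exact abs_balanced_le hv j
        _ = δ := by field_simp
    refine ⟨⟨by positivity, fun j => ?_, fun j => ?_, fun j => ?_, fun j => ?_⟩, ?_⟩
    · have := (abs_le.1 (hb j)).1; linarith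
    · have := (abs_le.1 (hb j)).2; linarith
    · have := (abs_le.1 (hb j)).1; linarith
    · have := (abs_le.1 (hb j)).2
      nlinarith
    · rw [Finset.sum_add_distrib, ← Finset.mul_sum, sum_balanced]
      simp [hτN]

end Ball

/-! ### Balls of Denjoy minimal sets -/

/-- A homeomorphism with an embedded full two-shift has balls of every dimension of Denjoy minimal
sets of given intrinsic rotation number all of whose points have itineraries with a given frequency
of ones. -/
theorem exists_embedded_ball {Z : Type*} [TopologicalSpace Z] [T2Space Z] [HasOuterApproxClosed Z]
    [MeasurableSpace Z] [BorelSpace Z] {f : Z ≃ₜ Z} {γ : TwoShift → Z} (hγ : Continuous γ)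
    (hinj : Function.Injective γ) (hf : ∀ s, f (γ s) = γ (shift s)) {α : ℝ} (hα : Irrational α)
    {t : ℝ} (ht0 : 0 < t) (ht1 : t < 1) (n : ℕ) :
    ∃ D : Metric.closedBall (0 : EuclideanSpace ℝ (Fin n)) 1 → StrictlyErgodicSet f,
      Topology.IsEmbedding D ∧ ∀ v, IsDenjoyMinimalSet f (D v).carrier α ∧
        ∀ z ∈ (D v).carrier, ∃ s, z = γ s ∧ HasFrequencyOfOnes s t := by
  obtain ⟨s, r, L, hLc, hLi, hL⟩ := exists_admissible_family n ht0 ht1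
  choose D hD hDμ hDc using fun v =>
    exists_strictlyErgodicSet hγ hinj hf hα (hL v).1.stepPair
  have hvol : IsProbabilityMeasure (volume : Measure UnitAddCircle) :=
    ⟨UnitAddCircle.measure_univ⟩
  have hcont : Continuous fun v => (D v).measure := by
    rw [ProbabilityMeasure.continuous_iff_forall_continuous_integral]
    intro φ
    refine (continuous_integral_code (s := s) hγ hLc α φ).congr fun v => ?_
    rw [hDμ, integral_map]
    · rfl
    · exact (hγ.measurable.comp
        (measurable_circleCode _ (hL v).1.stepPair.measurable_right)).aemeasurable
    · exact φ.continuous.aestronglyMeasurable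
  -- Equal measures force a common point, hence a common code, hence step functions that are
  -- translates of each other.
  have hinjμ : Function.Injective fun v => (D v).measure := by
    intro v w h
    obtain ⟨z, hz1, hz2⟩ := StrictlyErgodicSet.inter_nonempty_of_measure_eq h
    obtain ⟨x, c, hc, hx⟩ := hDc v z hz1
    obtain ⟨y, c', hc', hy⟩ := hDc w z hz2
    obtain rfl := hinj (hc.symm.trans hc')
    have htr := (hL v).1.stepPair.eq_translate_of_code_eq hα (hL w).1.stepPair hx hy
    refine hLi ((hL v).1.eq_of_translate (hL w).1 (c := x - y) fun u => ?_)
    have := htr (u - y)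
    rwa [add_sub_cancel, show x + (u - y) = u + (x - y) by ring] at this
  have hemb : Topology.IsEmbedding ((StrictlyErgodicSet.measure (f := f)) ∘ D) :=
    (hcont.isClosedEmbedding hinjμ).isEmbedding
  have hind : Topology.IsInducing (StrictlyErgodicSet.measure (f := f)) := ⟨rfl⟩
  refine ⟨D, ⟨hind.of_comp_iff.1 hemb.isInducing, hemb.injective.of_comp⟩,
    fun v => ⟨hD v, fun z hz => ?_⟩⟩
  obtain ⟨x, c, hc, hx⟩ := hDc v z hz
  have hfreq := (hL v).1.stepPair.hasFrequencyOfOnes hα hx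
  rw [(hL v).1.volume_oneSet, (hL v).2] at hfreq
  exact ⟨c, hc, hfreq⟩

end

end DenjoyAnnulus

theorem proposition4p2
    (f : DenjoyAnnulus.Annulus ≃ₜ DenjoyAnnulus.Annulus)
    (hf : DenjoyAnnulus.HasRotaryHorseshoe f)
    (α : ℝ) (hα : Irrational α)
    (β : UnitAddCircle) (hβ : β ≠ 0)
    (n : ℕ) :
    ∃ B : Set (DenjoyAnnulus.StrictlyErgodicSet f),
      B ⊆ DenjoyAnnulus.denjoySets f α β ∧
        Nonempty (B ≃ₜ Metric.closedBall (0 : EuclideanSpace ℝ (Fin n)) 1) := by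
  obtain ⟨F, Ω, c, hF, -, hΩ, hconj, hrot⟩ := hf
  obtain ⟨t, ⟨ht0, ht1⟩, rfl⟩ := AddCircle.eq_coe_Ico β
  have ht : 0 < t := lt_of_le_of_ne ht0 fun h => hβ (by rw [← h]; rfl)
  have hequiv : ∀ s, f (c.symm s) = c.symm (DenjoyAnnulus.shift s) := fun s => by
    have hmem : f (c.symm s) ∈ Ω := hΩ.subset (Set.mem_image_of_mem f (c.symm s).2)
    have h := hconj (c.symm s) ⟨_, hmem⟩ rfl
    rw [Homeomorph.apply_symm_apply] at h
    rw [← h, Homeomorph.symm_apply_apply]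
  obtain ⟨D, hD, hDv⟩ := DenjoyAnnulus.exists_embedded_ball (f := f)
    (γ := fun s => (c.symm s : DenjoyAnnulus.Annulus))
    (continuous_subtype_val.comp c.symm.continuous)
    (Subtype.val_injective.comp c.symm.injective) hequiv hα ht ht1 n
  refine ⟨Set.range D, ?_, ⟨hD.toHomeomorph.symm⟩⟩
  rintro _ ⟨v, rfl⟩
  refine ⟨(hDv v).1, F, hF, t, rfl, fun z hz => ?_⟩
  obtain ⟨s, rfl, hs⟩ := (hDv v).2 z hz
  -- The horseshoe property converts frequency `t` into rotation number `t` for the lift `F`.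
  refine (hrot (c.symm s) t).2 ?_
  rwa [Homeomorph.apply_symm_apply]
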